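/- Let $n\ge 0$, let $X$ be a complex manifold of dimension $2n+1$ (for instance a smooth complex projective variety), and let $F^{p}H^{k}_{dR}(X)\subset H^{k}_{dR}(X)$ (complex coefficients) be the space of classes of closed $C^\infty$ forms in $F^{p}A^{k}(X)=\bigoplus_{a\ge p}A^{a,k-a}(X)$. (For $X$ smooth projective this is the Hodge filtration.) Let $D=\{s\in\mathbb C: |s|<r\}$, let $Z$ be a complex manifold of dimension $n+1$, let $f:Z\to D$ be a proper holomorphic submersion with fibres $Z_s=f^{-1}(s)$, and let $g:Z\to X$ be a holomorphic map. (In the case of a family of algebraic cycles in $X$, $g$ is injective on each $Z_s$; this is not needed.) Let $\omega$ be a closed form in $F^{n+1}A^{2n+1}(X)$ representing a class in $F^{n+1}H^{2n+1}_{dR}(X)$. Then there is a $C^\infty$ form $\theta$ of degree $2n$ on $Z$ with $g^*\omega=df\wedge\theta$; the restriction of any such $\theta$ to a fibre $Z_s$ is the Gelfand–Leray form $\frac{\omega}{df}$. Fix $s_0\in D$ and, for $s\in D$, put $$I(s):=\int_{f^{-1}(\gamma_s)} g^*\omega,$$ where $\gamma_s$ is any piecewise $C^1$ path in $D$ from $s_0$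 to $s$; here $f^{-1}(\gamma_s)$ is the $(2n+1)$-dimensional manifold $\{(t,z)\in[0,1]\times Z: f(z)=\gamma_s(t)\}$, mapped to $Z$ and oriented by $\partial/\partial t$ followed by the complex orientation of the fibres. Then, whatever the choice of the paths $\gamma_s$, the function $I$ is holomorphic on $D$, and for every $s\in D$ $$I'(s)=\int_{Z_s}\frac{\omega}{df},$$ where $Z_s$ carries its complex orientation. -/

import Mathlib

open scoped Manifold ContDiff

noncomputable section

/-! ### Complex-valued differential forms on a complex manifold

`M` is a complex manifold with charts in `Fin m → ℂ`. Its tangent space at `x` is `Fin m → ℂ`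
(via the preferred chart at `x`, Mathlib's convention for `TangentSpace`). -/

/-- Not necessarily smooth complex-valued differential forms of degree `k`: to each point `x` is
attached a real-alternating `k`-linear map on `T_x M` with values in `ℂ`. -/
def FormField (m : ℕ) (M : Type*) (k : ℕ) : Type _ :=
  M → (Fin m → ℂ) [⋀^Fin k]→L[ℝ] ℂ

instance (m : ℕ) (M : Type*) (k : ℕ) : AddCommGroup (FormField m M k) :=
  inferInstanceAs (AddCommGroup (M → (Fin m → ℂ) [⋀^Fin k]→L[ℝ] ℂ))

instance (m : ℕ) (M : Type*) (k : ℕ) : Module ℂ (FormField m M k) :=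
  inferInstanceAs (Module ℂ (M → (Fin m → ℂ) [⋀^Fin k]→L[ℝ] ℂ))

section Forms

variable {m : ℕ} {M : Type*} [TopologicalSpace M] [ChartedSpace (Fin m → ℂ) M] {k : ℕ}

/-- The derivative at `x` of a map between complex manifolds, as a complex linear map. -/
def tangentMapAt {m' : ℕ} {M' : Type*} [TopologicalSpace M'] [ChartedSpace (Fin m' → ℂ) M']
    (g : M → M') (x : M) : (Fin m → ℂ) →L[ℂ] (Fin m' → ℂ) :=
  mfderiv 𝓘(ℂ, Fin m → ℂ) 𝓘(ℂ, Fin m' → ℂ) g x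

/-- The derivative at `x` of a complex-valued function, as a complex linear form. -/
def differentialAt (f : M → ℂ) (x : M) : (Fin m → ℂ) →L[ℂ] ℂ :=
  mfderiv 𝓘(ℂ, Fin m → ℂ) 𝓘(ℂ, ℂ) f x

/-- The pull-back `g^* α` of a form under a map of complex manifolds. -/
def pullbackForm {m' : ℕ} {M' : Type*} [TopologicalSpace M'] [ChartedSpace (Fin m' → ℂ) M']
    (g : M → M') (α : FormField m' M' k) : FormField m M k :=
  fun x => (α (g x)).compContinuousLinearMap ((tangentMapAt g x).restrictScalars ℝ)

/-- The expression of a form in a chart `φ`, i.e. its pull-back under `φ⁻¹`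
(meaningful on `φ.target`). -/
def coordForm (α : FormField m M k) (φ : OpenPartialHomeomorph M (Fin m → ℂ)) :
    (Fin m → ℂ) → (Fin m → ℂ) [⋀^Fin k]→L[ℝ] ℂ :=
  fun y => (α (φ.symm y)).compContinuousLinearMap ((tangentMapAt φ.symm y).restrictScalars ℝ)

lemma coordForm_add (α β : FormField m M k) (φ : OpenPartialHomeomorph M (Fin m → ℂ)) :
    coordForm (α + β) φ = coordForm α φ + coordForm β φ := rfl

lemma coordForm_smul (c : ℂ) (α : FormField m M k)
    (φ : OpenPartialHomeomorph M (Fin m → ℂ)) :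
    coordForm (c • α) φ = c • coordForm α φ := rfl

lemma coordForm_zero (φ : OpenPartialHomeomorph M (Fin m → ℂ)) :
    coordForm (0 : FormField m M k) φ = 0 := rfl

variable (m M k) in
/-- The space of smooth (`C^∞`) complex-valued `k`-forms: those which are smooth in all charts. -/
def smoothForms : Submodule ℂ (FormField m M k) where
  carrier := {α | ∀ φ ∈ atlas (Fin m → ℂ) M, ContDiffOn ℝ ∞ (coordForm α φ) φ.target}
  zero_mem' φ _ := by rw [coordForm_zero]; exact contDiffOn_const
  add_mem' ha hb φ hφ := by rw [coordForm_add]; exact (ha φ hφ).add (hb φ hφ)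
  smul_mem' c α ha φ hφ := by rw [coordForm_smul]; exact (ha φ hφ).const_smul c

/-- The exterior derivative: at `x` it is computed in the preferred chart at `x`. -/
def extDerivForm (α : FormField m M k) : FormField m M (k + 1) :=
  fun x => extDeriv (coordForm α (chartAt (Fin m → ℂ) x)) (chartAt (Fin m → ℂ) x x)

lemma differentiableAt_coordForm {α : FormField m M k} (h : α ∈ smoothForms m M k) (x : M) :
    DifferentiableAt ℝ (coordForm α (chartAt (Fin m → ℂ) x)) (chartAt (Fin m → ℂ) x x) :=
  ((h _ (chart_mem_atlas _ x)).contDiffAt ((chartAt (Fin m → ℂ) x).open_target.mem_nhds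
    (mem_chart_target _ x))).differentiableAt (by simp)

variable (m M k) in
/-- The exterior derivative as a linear map on smooth forms. -/
def extDerivLin : smoothForms m M k →ₗ[ℂ] FormField m M (k + 1) where
  toFun α := extDerivForm α.1
  map_add' α β := by
    funext x
    exact extDeriv_add (differentiableAt_coordForm α.2 x) (differentiableAt_coordForm β.2 x)
  map_smul' c α := by
    funext x
    have h := differentiableAt_coordForm α.2 x
    change extDeriv (c • coordForm α.1 _) _ = c • extDeriv (coordForm α.1 _) _
    rw [extDeriv, fderiv_const_smul h]
    ext v
    simp [extDeriv, ContinuousAlternatingMap.alternatizeUncurryFin_apply, Finset.smul_sum]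

variable (m M) in
/-- Closed smooth `k`-forms. -/
def closedForms (k : ℕ) : Submodule ℂ (FormField m M k) :=
  (LinearMap.ker (extDerivLin m M k)).map (smoothForms m M k).subtype

variable (m M) in
/-- Exact `k`-forms. -/
def exactForms : (k : ℕ) → Submodule ℂ (FormField m M k)
  | 0 => ⊥
  | k + 1 => LinearMap.range (extDerivLin m M k)

variable (m M) in
/-- The de Rham cohomology `H^k_dR(M)` with complex coefficients: closed forms modulo exact
forms. -/
abbrev DeRham (k : ℕ) : Type _ :=
  closedForms m M k ⧸ (exactForms m M k).comap (closedForms m M k).subtype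

/-! ### Types of forms and the Hodge filtration -/

variable (m) in
/-- `Λ^{a,b}`: the alternating forms `α` of degree `k = a + b` on `ℂ^m` of type `(a, b)`, i.e.
those with `α (c v₁, …, c v_k) = c ^ a * conj c ^ b * α (v₁, …, v_k)` for all complex `c`. -/
def formsOfType (k a b : ℕ) : Submodule ℂ ((Fin m → ℂ) [⋀^Fin k]→L[ℝ] ℂ) where
  carrier := {α | ∀ (c : ℂ) (v : Fin k → Fin m → ℂ),
    α (fun i => c • v i) = c ^ a * (starRingEnd ℂ c) ^ b * α v}
  zero_mem' c v := by simp
  add_mem' ha hb c v := by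
    simp only [ContinuousAlternatingMap.add_apply, ha c v, hb c v]; ring
  smul_mem' t α ha c v := by
    simp only [ContinuousAlternatingMap.smul_apply, ha c v, smul_eq_mul]; ring

variable (m) in
/-- `F^p Λ^k = ⨁_{a ≥ p} Λ^{a, k - a}`. -/
def hodgeAlternating (p k : ℕ) : Submodule ℂ ((Fin m → ℂ) [⋀^Fin k]→L[ℝ] ℂ) :=
  ⨆ a ∈ Finset.Icc p k, formsOfType m k a (k - a)

variable (m M) in
/-- `F^p` on form fields: all values lie in `F^p Λ^k`. -/
def hodgeForms (p k : ℕ) : Submodule ℂ (FormField m M k) where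
  carrier := {α | ∀ x, α x ∈ hodgeAlternating m p k}
  zero_mem' _ := zero_mem _
  add_mem' ha hb x := add_mem (ha x) (hb x)
  smul_mem' c _ ha x := Submodule.smul_mem _ c (ha x)

variable (m M) in
/-- The Hodge filtration `F^p H^k_dR(M)`: the classes of closed forms in
`F^p A^k = ⨁_{a ≥ p} A^{a, k - a}`. -/
def hodgeFiltration (p k : ℕ) : Submodule ℂ (DeRham m M k) :=
  ((hodgeForms m M p k).comap (closedForms m M k).subtype).map
    ((exactForms m M k).comap (closedForms m M k).subtype).mkQ

end Forms

/-! ### Integration over the fibres and over preimages of paths -/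

/-- The real basis `e₁, i e₁, e₂, i e₂, …` of `ℂ^n`, positive for the complex orientation and
spanning a cube of Lebesgue volume one. -/
def realFrame (n : ℕ) : Fin (2 * n) → Fin n → ℂ := fun k =>
  Pi.single ⟨k / 2, by omega⟩ (if (k : ℕ) % 2 = 0 then 1 else Complex.I)

section Integration

variable {n : ℕ} {Z : Type*} [TopologicalSpace Z] [ChartedSpace (Fin (n + 1) → ℂ) Z]

/-- A finite system of holomorphic charts of `Z` whose first coordinate is `f` (so that the fibre
over `s` is the slice `{(s, w)}`), and compactly supported continuous functions subordinate to it
whose sum is `1` on the set `K`. -/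
structure AdaptedPartition (f : Z → ℂ) (K : Set Z) where
  /-- the number of charts -/
  card : ℕ
  /-- the charts -/
  chart : Fin card → OpenPartialHomeomorph Z (Fin (n + 1) → ℂ)
  chart_mem : ∀ j, chart j ∈ IsManifold.maximalAtlas 𝓘(ℂ, Fin (n + 1) → ℂ) ω Z
  chart_zero : ∀ j, ∀ z ∈ (chart j).source, chart j z 0 = f z
  /-- the partition functions -/
  weight : Fin card → Z → ℝ
  continuous_weight : ∀ j, Continuous (weight j)
  hasCompactSupport_weight : ∀ j, HasCompactSupport (weight j)
  tsupport_subset : ∀ j, tsupport (weight j) ⊆ (chart j).source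
  sum_weight : ∀ z ∈ K, ∑ j, weight j z = 1

open Classical in
/-- The contribution of one chart to the integral of a `2n`-form `θ` over the fibre `f = s`. -/
def chartFibreIntegral (θ : FormField (n + 1) Z (2 * n))
    (φ : OpenPartialHomeomorph Z (Fin (n + 1) → ℂ)) (ρ : Z → ℝ) (s : ℂ) : ℂ :=
  ∫ w : Fin n → ℂ,
    if (Fin.cons s w : Fin (n + 1) → ℂ) ∈ φ.target then
      (ρ (φ.symm (Fin.cons s w)) : ℂ) *
        coordForm θ φ (Fin.cons s w) (fun k => Fin.cons 0 (realFrame n k))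
    else 0

open Classical in
/-- The integral `∫_{Z_s} θ` of a `2n`-form over the fibre `Z_s = f⁻¹(s)`, with its complex
orientation, computed with a partition of unity on `Z_s` (any one gives the same value). -/
def fibreIntegral (f : Z → ℂ) (θ : FormField (n + 1) Z (2 * n)) (s : ℂ) : ℂ :=
  if h : Nonempty (AdaptedPartition f (f ⁻¹' {s})) then
    ∑ j, chartFibreIntegral θ (h.some.chart j) (h.some.weight j) s
  else 0

open Classical in
/-- The contribution of one chart to the integral of a `(2n+1)`-form `η` over the preimage of the
path `γ`: the integral of the pull-back of `η` under `(t, w) ↦ φ⁻¹ (γ t, w)`. -/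
def chartPreimageIntegral (η : FormField (n + 1) Z (2 * n + 1))
    (φ : OpenPartialHomeomorph Z (Fin (n + 1) → ℂ)) (ρ : Z → ℝ) (γ : ℝ → ℂ) : ℂ :=
  ∫ p : ℝ × (Fin n → ℂ) in Set.Icc (0 : ℝ) 1 ×ˢ Set.univ,
    if (Fin.cons (γ p.1) p.2 : Fin (n + 1) → ℂ) ∈ φ.target then
      (ρ (φ.symm (Fin.cons (γ p.1) p.2)) : ℂ) *
        coordForm η φ (Fin.cons (γ p.1) p.2)
          (Fin.cons (Fin.cons (deriv γ p.1) 0) (fun k => Fin.cons 0 (realFrame n k)))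
    else 0

open Classical in
/-- The integral `∫_{f⁻¹(γ)} η` of a `(2n+1)`-form over the chain `f⁻¹(γ)`, that is over the
`(2n+1)`-dimensional manifold `{(t, z) ∈ [0,1] × Z | f z = γ t}` mapped to `Z`, oriented by `∂/∂t`
followed by the complex orientation of the fibres. It is computed with a partition of unity on
`f⁻¹(γ([0,1]))` (any one gives the same value). -/
def preimageIntegral (f : Z → ℂ) (η : FormField (n + 1) Z (2 * n + 1)) (γ : ℝ → ℂ) : ℂ :=
  if h : Nonempty (AdaptedPartition f (f ⁻¹' (γ '' Set.Icc 0 1))) then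
    ∑ j, chartPreimageIntegral η (h.some.chart j) (h.some.weight j) γ
  else 0

/-- `θ` is a Gelfand–Leray form `η / df`: a smooth `2n`-form with `η = df ∧ θ`. Its restriction
to the fibres of a submersion `f` is determined by `η`. -/
def IsGelfandLeray (f : Z → ℂ) (η : FormField (n + 1) Z (2 * n + 1))
    (θ : FormField (n + 1) Z (2 * n)) : Prop :=
  θ ∈ smoothForms (n + 1) Z (2 * n) ∧
    ∀ (z : Z) (v : Fin (2 * n + 1) → Fin (n + 1) → ℂ),
      η z v = ∑ i : Fin (2 * n + 1), (-1) ^ (i : ℕ) * differentialAt f z (v i) * θ z (i.removeNth v)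

end Integration

/-- `γ`, restricted to `[0,1]`, is a piecewise continuously differentiable path from `a` to `b`
in `D`. -/
structure IsPiecewiseC1Path (D : Set ℂ) (a b : ℂ) (γ : ℝ → ℂ) : Prop where
  source : γ 0 = a
  target : γ 1 = b
  mem : ∀ t ∈ Set.Icc (0 : ℝ) 1, γ t ∈ D
  continuousOn : ContinuousOn γ (Set.Icc 0 1)
  piecewise : ∃ P : Finset ℝ, ∀ a b : ℝ, Set.Icc a b ⊆ Set.Icc 0 1 →
    (∀ t ∈ P, t ∉ Set.Ioo a b) → ContDiffOn ℝ 1 γ (Set.Icc a b)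

end

/-! ### Holomorphic functions of several complex variables are analytic. -/

section SeveralVariables

open Metric Set

variable {E F : Type*} [NormedAddCommGroup E] [NormedSpace ℂ E]
  [NormedAddCommGroup F] [NormedSpace ℂ F]

/-! Write `η` for the pull-back of the form to `Z`, and `J s` for the integral over the fibre of a
Gelfand–Leray form `θ`. The heart of the matter is that integrating `η` along the fibres gives the
1-form `J ds` on the disc; since `η` is closed, so is `J ds`, which means that `J` is holomorphic.
It then has a primitive on the disc, and the integral of `η` over the preimage of a path is the
increment of that primitive.

Existence of `θ` is a matter of type. A complex linear pull-back preserves types, so `η` lies in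
`F^{n+1}`; as `Z` has dimension `n + 1`, the form `df ∧ η` would have more than `n + 1` holomorphic
directions and vanishes (`wedgeLinear_eq_zero_of_mem_formsOfType`). Contracting `df ∧ η = 0` with a
vector `u` such that `df u = 1` gives `η = df ∧ ι_u η`. Local contractions are glued by a partition
of unity, the condition on `θ` being affine (`exists_isGelfandLeray`).

Closedness of `J ds` is proved chart by chart, without trivialising the family. For a partition of
unity `ρ_j` in charts with first coordinate `f`, let `J_j` be the contribution of `ρ_j θ`. Stokes'
formula along the fibres (`integral_extDeriv_cons`) says that the fibre integral of `d(ρ_j η)`,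
contracted with lifts of `1` and `I`, is `I ∂_1 J_j - ∂_I J_j`. The forms `d(ρ_j η)` add up to `dη =
0`, which yields the Cauchy–Riemann equation for `J` (`differentiableAt_sum_chartFibreIntegral`).

Fubini turns the integral over the preimage of `γ` into the integral of `γ' J(γ)` over `[0,1]`, to
which the fundamental theorem of calculus applies (`IsPiecewiseC1Path.preimageIntegral_eq`).

Both integrals are defined by an arbitrarily chosen partition of unity. Independence of this choice
(`sum_chartFibreIntegral_eq`) rests on the change of variables formula, the real Jacobian of a
holomorphic map being the squared modulus of its complex determinant. The maps are only assumed
complex differentiable while the manifolds have analytic atlases, so analyticity of holomorphic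
functions of several variables is also needed. -/

/-- Cauchy's estimate for the Fréchet derivative. -/
lemma norm_fderiv_le_of_norm_le_on_ball {f : E → F} {c : E} {R M : ℝ} (hR : 0 < R)
    (hf : DifferentiableOn ℂ f (ball c R)) (hM : ∀ x ∈ ball c R, ‖f x‖ ≤ M) :
    ‖fderiv ℂ f c‖ ≤ 2 * M / R := by
  -- The values lie within `2 * M` of `f c`, whence the factor 2.
  refine Complex.norm_fderiv_le_div_of_mapsTo_ball hf (fun x hx => ?_) hR
  rw [mem_closedBall, dist_eq_norm]
  linarith [norm_sub_le (f x) (f c), hM x hx, hM c (mem_ball_self hR)]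

/-- The directional derivatives of a holomorphic function of several variables are holomorphic. -/
lemma differentiableOn_fderiv_apply_of_isOpen [FiniteDimensional ℂ E] [FiniteDimensional ℂ F]
    {f : E → F} {U : Set E} (hU : IsOpen U) (hf : DifferentiableOn ℂ f U) (v : E) :
    DifferentiableOn ℂ (fun x => fderiv ℂ f x v) U := by
  have : CompleteSpace F := FiniteDimensional.complete ℂ F
  -- By linearity in `v` only short vectors matter; for these the unit circle in direction `v` stays
  -- where `f` is bounded.
  suffices h : ∀ x₀ ∈ U, ∃ ρ > 0, ∀ v, ‖v‖ ≤ ρ →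
      DifferentiableAt ℂ (fun x => fderiv ℂ f x v) x₀ by
    intro x₀ hx₀
    obtain ⟨ρ, hρ, h⟩ := h x₀ hx₀
    have hpos : 0 < ρ / (‖v‖ + 1) := by positivity
    set c : ℂ := ((ρ / (‖v‖ + 1) : ℝ) : ℂ) with hc
    have hc0 : c ≠ 0 := by rw [hc]; exact_mod_cast hpos.ne'
    have h1 := h (c • v) (by
      rw [norm_smul, hc, Complex.norm_real, Real.norm_of_nonneg hpos.le, div_mul_eq_mul_div,
        div_le_iff₀ (by positivity)]
      nlinarith [norm_nonneg v])
    have h2 : (fun x => fderiv ℂ f x v) = fun x => c⁻¹ • fderiv ℂ f x (c • v) := by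
      funext x; rw [map_smul, smul_smul, inv_mul_cancel₀ hc0, one_smul]
    rw [h2]
    exact (h1.const_smul _).differentiableWithinAt
  intro x₀ hx₀
  -- choose a ball on which `f` is bounded
  obtain ⟨r₁, hr₁, hb₁⟩ := Metric.isOpen_iff.1 hU x₀ hx₀
  obtain ⟨r₂, hr₂, hb₂⟩ := Metric.continuousAt_iff.1
    (hf.continuousOn.continuousAt (hU.mem_nhds hx₀)) 1 one_pos
  set r := min r₁ r₂ with hr
  have hrpos : 0 < r := lt_min hr₁ hr₂
  have hrU : ball x₀ r ⊆ U := (ball_subset_ball (min_le_left _ _)).trans hb₁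
  have hbd : ∀ x ∈ ball x₀ r, ‖f x‖ ≤ ‖f x₀‖ + 1 := fun x hx => by
    have := hb₂ (lt_of_lt_of_le (mem_ball.1 hx) (min_le_right _ _))
    rw [dist_eq_norm] at this
    linarith [norm_sub_norm_le (f x) (f x₀)]
  set M := ‖f x₀‖ + 1
  -- For `‖v‖ ≤ r / 8` and `‖z‖ < 2`, a point within `r / 4` of `x₀` moves by at most `r / 4`. It
  -- stays within `r / 2` of `x₀`, which leaves a margin `r / 2` for Cauchy's estimate.
  refine ⟨r / 8, by positivity, fun v hv => ?_⟩
  have hmem : ∀ x ∈ ball x₀ (r / 4), ∀ z : ℂ, ‖z‖ < 2 → x + z • v ∈ ball x₀ (r / 2) := by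
    intro x hx z hz
    rw [mem_ball, dist_eq_norm] at hx ⊢
    calc ‖x + z • v - x₀‖ = ‖(x - x₀) + z • v‖ := by congr 1; abel
      _ ≤ ‖x - x₀‖ + ‖z‖ * ‖v‖ := (norm_add_le _ _).trans (by rw [norm_smul])
      _ < r / 2 := by nlinarith [norm_nonneg v, norm_nonneg z]
  have hdiff : ∀ y ∈ ball x₀ (r / 2), DifferentiableAt ℂ f y := fun y hy =>
    (hf.differentiableAt (hU.mem_nhds (hrU (ball_subset_ball (by linarith) hy))))
  have hbound : ∀ y ∈ ball x₀ (r / 2), ‖fderiv ℂ f y‖ ≤ 2 * M / (r / 2) := fun y hy => by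
    have hsub : ball y (r / 2) ⊆ ball x₀ r := by
      refine ball_subset_ball' ?_
      have := mem_ball.1 hy
      linarith
    exact norm_fderiv_le_of_norm_le_on_ball (by positivity) (hf.mono (hsub.trans hrU))
      fun x hx => hbd x (hsub hx)
  -- Cauchy's formula for the derivative in the direction `v`
  have hcauchy : ∀ x ∈ ball x₀ (r / 4),
      (∮ z in C(0, 1), (1 / z ^ 2) • f (x + z • v)) = (2 * Real.pi * Complex.I) • fderiv ℂ f x v := by
    intro x hx
    have hder : ∀ z : ℂ, ‖z‖ < 2 →
        HasDerivAt (fun z : ℂ => f (x + z • v)) (fderiv ℂ f (x + z • v) v) z := fun z hz => by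
      have h1 : HasDerivAt (fun z : ℂ => x + z • v) v z := by
        simpa using ((hasDerivAt_id z).smul_const v).const_add x
      exact (hdiff _ (hmem x hx z hz)).hasFDerivAt.comp_hasDerivAt z h1
    have h := DifferentiableOn.deriv_eq_smul_circleIntegral (f := fun z : ℂ => f (x + z • v))
      (c := 0) (R := 1) one_pos (fun z hz => (hder z (by
        rw [mem_closedBall_zero_iff] at hz; linarith)).differentiableAt.differentiableWithinAt)
    rw [(hder 0 (by simp)).deriv] at h
    simpa using h
  have hev : (fun x => fderiv ℂ f x v) =ᶠ[nhds x₀]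
      fun x => (2 * Real.pi * Complex.I : ℂ)⁻¹ • ∮ z in C(0, 1), (1 / z ^ 2) • f (x + z • v) := by
    filter_upwards [ball_mem_nhds x₀ (show 0 < r / 4 by positivity)] with x hx
    rw [hcauchy x hx, smul_smul, inv_mul_cancel₀ (by simp [Real.pi_ne_zero]), one_smul]
  refine DifferentiableAt.congr_of_eventuallyEq (DifferentiableAt.const_smul ?_ _) hev
  borelize E F
  have : ProperSpace E := FiniteDimensional.proper ℂ E
  have : ProperSpace (E →L[ℂ] F) := FiniteDimensional.proper ℂ _
  have hcm : Continuous (circleMap 0 1) := continuous_circleMap 0 1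
  have hn : ∀ t : ℝ, ‖circleMap 0 1 t‖ < 2 := fun t => by simp
  have hne : ∀ t : ℝ, circleMap 0 1 t ≠ 0 := fun t => by simp
  have hcont : ∀ x ∈ ball x₀ (r / 4), Continuous fun t : ℝ =>
      deriv (circleMap 0 1) t • (1 / circleMap 0 1 t ^ 2) • f (x + circleMap 0 1 t • v) := by
    intro x hx
    simp only [deriv_circleMap]
    refine (hcm.mul continuous_const).smul ((continuous_const.div (hcm.pow 2)
      fun t => pow_ne_zero _ (hne t)).smul ?_)
    refine continuous_iff_continuousAt.2 fun t => ?_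
    refine ContinuousAt.comp (g := f) (hdiff _ (hmem x hx _ (hn t))).continuousAt ?_
    fun_prop
  have key := intervalIntegral.hasFDerivAt_integral_of_dominated_of_fderiv_le (𝕜 := ℂ)
    (μ := MeasureTheory.volume) (a := 0) (b := 2 * Real.pi) (x₀ := x₀) (s := ball x₀ (r / 4))
    (F := fun x t => deriv (circleMap 0 1) t • (1 / circleMap 0 1 t ^ 2) •
      f (x + circleMap 0 1 t • v))
    (F' := fun x t => deriv (circleMap 0 1) t • (1 / circleMap 0 1 t ^ 2) •
      fderiv ℂ f (x + circleMap 0 1 t • v))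
    (bound := fun _ => 2 * M / (r / 2))
    (ball_mem_nhds _ (by positivity)) ?_ ?_ ?_ ?_ ?_ ?_
  · exact key.differentiableAt
  · filter_upwards [ball_mem_nhds x₀ (show 0 < r / 4 by positivity)] with x hx
    exact (hcont x hx).aestronglyMeasurable
  · exact (hcont x₀ (mem_ball_self (by positivity))).intervalIntegrable _ _
  -- Continuity of the derivative is not yet known; its measurability is enough to differentiate
  -- under the integral.
  · refine AEMeasurable.aestronglyMeasurable (Measurable.aemeasurable ?_)
    simp only [deriv_circleMap]
    refine Measurable.smul (hcm.mul continuous_const).measurable (Measurable.smul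
      ((continuous_const.div (hcm.pow 2) fun t => pow_ne_zero _ (hne t)).measurable) ?_)
    refine (measurable_fderiv ℂ f).comp (Continuous.measurable ?_)
    fun_prop
  · refine Filter.Eventually.of_forall fun t _ x hx => ?_
    rw [norm_smul, norm_smul]
    simpa using hbound _ (hmem x hx _ (hn t))
  · exact intervalIntegrable_const
  · refine Filter.Eventually.of_forall fun t _ x hx => ?_
    have h1 : HasFDerivAt (fun x => x + circleMap 0 1 t • v) (ContinuousLinearMap.id ℂ E) x :=
      (hasFDerivAt_id x).add_const _
    exact (((hdiff _ (hmem x hx _ (hn t))).hasFDerivAt.comp x h1).const_smul _).const_smul _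

/-- Holomorphic functions of several variables are infinitely differentiable. -/
lemma DifferentiableOn.contDiffOn_of_finiteDimensional
    [FiniteDimensional ℂ E] [FiniteDimensional ℂ F]
    {f : E → F} {U : Set E} (hU : IsOpen U) (hf : DifferentiableOn ℂ f U) :
    ContDiffOn ℂ ∞ f U := by
  rw [contDiffOn_infty]
  intro k
  induction k generalizing f with
  | zero => exact_mod_cast contDiffOn_zero.2 hf.continuousOn
  | succ k ih =>
    have hk : ((k + 1 : ℕ) : WithTop ℕ∞) = (k : WithTop ℕ∞) + 1 := by push_cast; rfl
    rw [hk, contDiffOn_succ_iff_fderiv_apply hU.uniqueDiffOn]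
    refine ⟨hf, fun h => absurd h (by simp), fun v => ?_⟩
    refine (ih (differentiableOn_fderiv_apply_of_isOpen hU hf v)).congr fun x hx => ?_
    rw [fderivWithin_of_isOpen hU hx]

/-- Cauchy's estimate is iterated: each derivative costs `δ` of the radius and a factor `2 / δ`. -/
lemma norm_iteratedFDeriv_le_of_norm_le_on_ball {f : E → F} {c : E} {R M δ : ℝ} (hδ : 0 < δ)
    (hf : ContDiffOn ℂ ∞ f (ball c R)) (hM : ∀ x ∈ ball c R, ‖f x‖ ≤ M) (k : ℕ) :
    ∀ y ∈ ball c (R - k * δ), ‖iteratedFDeriv ℂ k f y‖ ≤ M * (2 / δ) ^ k := by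
  induction k with
  | zero => intro y hy; simpa using hM y (by simpa using hy)
  | succ k ih =>
    intro y hy
    have hsub : ball y δ ⊆ ball c (R - k * δ) := by
      refine ball_subset_ball' ?_
      have := mem_ball.1 hy
      push_cast at this
      linarith
    rw [← norm_fderiv_iteratedFDeriv]
    refine (norm_fderiv_le_of_norm_le_on_ball hδ (fun x hx => ?_) fun x hx => ih x (hsub hx)).trans
      (le_of_eq (by rw [pow_succ]; ring))
    have hx' : x ∈ ball c R := ball_subset_ball (by nlinarith [k.cast_nonneg (α := ℝ)]) (hsub hx)
    exact ((hf.contDiffAt (isOpen_ball.mem_nhds hx')).differentiableAt_iteratedFDeriv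
      (by exact_mod_cast WithTop.coe_lt_top k)).differentiableWithinAt

/-- This reduces the Taylor expansion to one variable: the coefficients along a complex line are
diagonal values of the iterated derivatives. -/
lemma iteratedDeriv_comp_line {f : E → F} {U : Set E} (hU : IsOpen U) (hf : ContDiffOn ℂ ∞ f U)
    (x y : E) (k : ℕ) : ∀ t : ℂ, x + t • y ∈ U →
      iteratedDeriv k (fun t : ℂ => f (x + t • y)) t =
        iteratedFDeriv ℂ k f (x + t • y) fun _ => y := by
  induction k with
  | zero => intro t _; simp
  | succ k ih =>
    intro t ht
    have hline : Continuous fun t : ℂ => x + t • y := by fun_prop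
    have hev : iteratedDeriv k (fun t : ℂ => f (x + t • y)) =ᶠ[nhds t]
        fun t => iteratedFDeriv ℂ k f (x + t • y) fun _ => y := by
      filter_upwards [hline.continuousAt.preimage_mem_nhds (hU.mem_nhds ht)] with s hs
      exact ih s hs
    rw [iteratedDeriv_succ, hev.deriv_eq, iteratedFDeriv_succ_apply_left]
    have h1 : HasDerivAt (fun t : ℂ => x + t • y) y t := by
      simpa using ((hasDerivAt_id t).smul_const y).const_add x
    have h2 := ((hf.contDiffAt (hU.mem_nhds ht)).differentiableAt_iteratedFDeriv (m := k)
      (by exact_mod_cast WithTop.coe_lt_top k)).hasFDerivAt.comp_hasDerivAt t h1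
    have h3 := (ContinuousMultilinearMap.apply ℂ (fun _ : Fin k => E) F
      (fun _ => y)).hasFDerivAt.comp_hasDerivAt t h2
    exact h3.deriv

/-- Holomorphic functions of several variables are analytic. -/
lemma DifferentiableOn.analyticAt_of_finiteDimensional
    [FiniteDimensional ℂ E] [FiniteDimensional ℂ F]
    {f : E → F} {U : Set E} (hU : IsOpen U) (hf : DifferentiableOn ℂ f U) {x : E} (hx : x ∈ U) :
    AnalyticAt ℂ f x := by
  have : CompleteSpace F := FiniteDimensional.complete ℂ F
  obtain ⟨r₁, hr₁, hb₁⟩ := Metric.isOpen_iff.1 hU x hx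
  obtain ⟨r₂, hr₂, hb₂⟩ := Metric.continuousAt_iff.1
    (hf.continuousOn.continuousAt (hU.mem_nhds hx)) 1 one_pos
  set R := min r₁ r₂ with hr
  have hR : 0 < R := lt_min hr₁ hr₂
  have hRU : ball x R ⊆ U := (ball_subset_ball (min_le_left _ _)).trans hb₁
  have hM : ∀ y ∈ ball x R, ‖f y‖ ≤ ‖f x‖ + 1 := fun y hy => by
    have := hb₂ (lt_of_lt_of_le (mem_ball.1 hy) (min_le_right _ _))
    rw [dist_eq_norm] at this
    linarith [norm_sub_norm_le (f y) (f x)]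
  set M := ‖f x‖ + 1
  have hM0 : 0 ≤ M := by positivity
  have hsm : ContDiffOn ℂ ∞ f (ball x R) := (hf.mono hRU).contDiffOn_of_finiteDimensional isOpen_ball
  let p : FormalMultilinearSeries ℂ E F := fun k => (k.factorial : ℂ)⁻¹ • iteratedFDeriv ℂ k f x
  -- the radius of convergence is at least `ρ`
  set ρ : ℝ := R / (4 * Real.exp 1) with hρ
  have hρpos : 0 < ρ := by positivity
  have hpk : ∀ k : ℕ, ‖p k‖ * ρ ^ k ≤ M := by
    intro k
    have hnorm : ‖p k‖ = (k.factorial : ℝ)⁻¹ * ‖iteratedFDeriv ℂ k f x‖ := by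
      simp [p, norm_smul]
    rcases Nat.eq_zero_or_pos k with rfl | hk
    · simpa [hnorm] using hM x (mem_ball_self hR)
    have hk' : (0 : ℝ) < k := by exact_mod_cast hk
    -- With this `δ`, the `k` steps use up half of the radius and the estimate is `M * (4 * k / R) ^
    -- k`. Since `k ^ k / k! ≤ exp k`, the choice `ρ = R / (4 * exp 1)` absorbs everything but `M`.
    have hδ : 0 < R / (2 * k) := by positivity
    have h1 := norm_iteratedFDeriv_le_of_norm_le_on_ball hδ hsm hM k x (mem_ball_self (by
      have : (k : ℝ) * (R / (2 * k)) = R / 2 := by field_simp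
      rw [this]; linarith))
    have h2 := Real.pow_div_factorial_le_exp (k : ℝ) hk'.le k
    have h3 : Real.exp k = Real.exp 1 ^ k := by rw [← Real.exp_nat_mul, mul_one]
    rw [hnorm]
    calc (k.factorial : ℝ)⁻¹ * ‖iteratedFDeriv ℂ k f x‖ * ρ ^ k
        ≤ (k.factorial : ℝ)⁻¹ * (M * (2 / (R / (2 * k))) ^ k) * ρ ^ k := by gcongr
      _ = M * ((k : ℝ) ^ k / k.factorial) * (Real.exp 1 ^ k)⁻¹ := by
        have h4 : (2 / (R / (2 * k))) ^ k * ρ ^ k = (k : ℝ) ^ k * (Real.exp 1 ^ k)⁻¹ := by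
          rw [← mul_pow, ← inv_pow, ← mul_pow]
          congr 1
          rw [hρ]
          field_simp
          norm_num
        calc _ = M * (k.factorial : ℝ)⁻¹ * ((2 / (R / (2 * k))) ^ k * ρ ^ k) := by ring
          _ = _ := by rw [h4]; ring
      _ ≤ M * Real.exp k * (Real.exp 1 ^ k)⁻¹ := by gcongr
      _ = M := by rw [h3]; field_simp
  have hρR : ρ ≤ R := by
    rw [hρ, div_le_iff₀ (by positivity)]
    nlinarith [Real.add_one_le_exp (1 : ℝ)]
  refine ⟨p, ENNReal.ofReal ρ, ?_, by simpa using hρpos, ?_⟩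
  · exact p.le_radius_of_bound (r := ρ.toNNReal) M fun k => by
      rw [Real.coe_toNNReal _ hρpos.le]; exact hpk k
  · intro y hy
    have hy' : ‖y‖ < R := by
      rw [Metric.eball_ofReal, mem_ball_zero_iff] at hy
      exact hy.trans_le hρR
    -- The denominator is the midpoint of `‖y‖` and `R`: it is positive even for `y = 0`, the disc
    -- contains `1`, and `t • y` remains shorter than `R`.
    have hmem : ∀ t ∈ ball (0 : ℂ) (R / (‖y‖ + (R - ‖y‖) / 2)), x + t • y ∈ ball x R := by
      intro t ht
      have hpos : 0 < ‖y‖ + (R - ‖y‖) / 2 := by linarith [norm_nonneg y]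
      rw [mem_ball_zero_iff, lt_div_iff₀ hpos] at ht
      rw [mem_ball, dist_eq_norm, add_sub_cancel_left, norm_smul]
      nlinarith [norm_nonneg t]
    have hd : DifferentiableOn ℂ (fun t : ℂ => f (x + t • y))
        (ball (0 : ℂ) (R / (‖y‖ + (R - ‖y‖) / 2))) := fun t ht => by
      have h1 : DifferentiableAt ℂ (fun t : ℂ => x + t • y) t := by fun_prop
      exact (DifferentiableAt.comp t (hf.differentiableAt (hU.mem_nhds (hRU (hmem t ht))))
        h1).differentiableWithinAt
    have h1 : (1 : ℂ) ∈ ball (0 : ℂ) (R / (‖y‖ + (R - ‖y‖) / 2)) := by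
      rw [mem_ball_zero_iff, lt_div_iff₀ (by linarith [norm_nonneg y]), norm_one]
      linarith
    have hs := Complex.hasSum_taylorSeries_on_ball hd h1
    simp only [one_smul, sub_zero, one_pow] at hs
    convert hs using 2 with k
    have h2 := iteratedDeriv_comp_line hU (hf.contDiffOn_of_finiteDimensional hU) x y k 0
      (by simpa using hx)
    rw [h2]
    simp [p]

end SeveralVariables

/-! ### Smooth families of alternating maps. -/

section AlternatingSmooth

variable {V W H : Type*} [NormedAddCommGroup V] [NormedSpace ℝ V] [FiniteDimensional ℝ V]
  [NormedAddCommGroup W] [NormedSpace ℝ W] [FiniteDimensional ℝ W]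
  [NormedAddCommGroup H] [NormedSpace ℝ H] {k : ℕ}

/-- The values of an alternating map on the tuples of basis vectors. -/
noncomputable def evalBasisTuples {ι : Type*} (e : Module.Basis ι ℝ V) :
    (V [⋀^Fin k]→L[ℝ] ℂ) →ₗ[ℝ] ((Fin k → ι) → ℂ) where
  toFun a I := a fun i => e (I i)
  map_add' _ _ := rfl
  map_smul' _ _ := rfl

omit [FiniteDimensional ℝ V] in
lemma evalBasisTuples_injective {ι : Type*} (e : Module.Basis ι ℝ V) :
    Function.Injective (evalBasisTuples (k := k) e) := fun a a' haa => by
  apply ContinuousAlternatingMap.toAlternatingMap_injective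
  exact Module.Basis.ext_alternating e fun I _ => congrFun haa I

lemma finiteDimensional_continuousAlternatingMap :
    FiniteDimensional ℝ (V [⋀^Fin k]→L[ℝ] ℂ) :=
  FiniteDimensional.of_injective _ (evalBasisTuples_injective (Module.finBasis ℝ V))

/-- In a basis of the finite-dimensional space of alternating maps, this is a finite sum of smooth
coefficients times fixed multilinear maps. -/
lemma ContDiffAt.continuousAlternatingMap_apply {f : H → V [⋀^Fin k]→L[ℝ] ℂ}
    {u : H → Fin k → V} {x : H} {m : WithTop ℕ∞} (hf : ContDiffAt ℝ m f x)
    (hu : ContDiffAt ℝ m u x) : ContDiffAt ℝ m (fun y => f y (u y)) x := by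
  have := finiteDimensional_continuousAlternatingMap (V := V) (k := k)
  let b := Module.finBasis ℝ (V [⋀^Fin k]→L[ℝ] ℂ)
  have h : (fun y => f y (u y)) = fun y => ∑ i, b.repr (f y) i • b i (u y) := by
    funext y
    conv_lhs => rw [← b.sum_repr (f y)]
    rw [ContinuousAlternatingMap.sum_apply]
    rfl
  rw [h]
  refine ContDiffAt.sum fun i _ => ContDiffAt.smul (f := fun y => b.repr (f y) i)
    (g := fun y => b i (u y)) ?_ ?_
  · exact ((LinearMap.toContinuousLinearMap (b.coord i)).contDiff.contDiffAt).comp x hf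
  · exact ((b i).toContinuousMultilinearMap.contDiff.contDiffAt).comp x hu

/-- Evaluation on tuples of basis vectors is injective and linear in finite dimension, so it has a
continuous left inverse. -/
lemma contDiffAt_continuousAlternatingMap_iff {f : H → V [⋀^Fin k]→L[ℝ] ℂ} {x : H}
    {m : WithTop ℕ∞} : ContDiffAt ℝ m f x ↔ ∀ v, ContDiffAt ℝ m (fun y => f y v) x := by
  refine ⟨fun h v => h.continuousAlternatingMap_apply contDiffAt_const, fun h => ?_⟩
  have := finiteDimensional_continuousAlternatingMap (V := V) (k := k)
  obtain ⟨L', hL'⟩ := LinearMap.exists_leftInverse_of_injective (evalBasisTuples (k := k)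
    (Module.finBasis ℝ V)) (LinearMap.ker_eq_bot.2 (evalBasisTuples_injective _))
  have h1 : f = fun y => LinearMap.toContinuousLinearMap L'
      (evalBasisTuples (Module.finBasis ℝ V) (f y)) := by
    funext y
    exact (LinearMap.congr_fun hL' (f y)).symm
  rw [h1]
  refine (LinearMap.toContinuousLinearMap L').contDiff.contDiffAt.comp x ?_
  exact contDiffAt_pi.2 fun I => h _

lemma ContDiffAt.compContinuousLinearMap {f : H → W [⋀^Fin k]→L[ℝ] ℂ} {A : H → V →L[ℝ] W}
    {x : H} {m : WithTop ℕ∞} (hf : ContDiffAt ℝ m f x) (hA : ContDiffAt ℝ m A x) :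
    ContDiffAt ℝ m (fun y => (f y).compContinuousLinearMap (A y)) x := by
  rw [contDiffAt_continuousAlternatingMap_iff]
  intro v
  refine hf.continuousAlternatingMap_apply (u := fun y i => A y (v i)) ?_
  exact contDiffAt_pi.2 fun i => hA.clm_apply contDiffAt_const

end AlternatingSmooth

/-! ### Maps and forms in coordinates; pull-backs and the exterior derivative. -/

section ComplexManifold

variable {m : ℕ} {M : Type*} [TopologicalSpace M] [ChartedSpace (Fin m → ℂ) M]
  {m' : ℕ} {M' : Type*} [TopologicalSpace M'] [ChartedSpace (Fin m' → ℂ) M']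
  {m'' : ℕ} {M'' : Type*} [TopologicalSpace M''] [ChartedSpace (Fin m'' → ℂ) M'']

/-- Needed because partitions of unity exist only in the real smooth category. -/
lemma contDiffGroupoid_complex_le_real :
    contDiffGroupoid ω 𝓘(ℂ, Fin m → ℂ) ≤ contDiffGroupoid ∞ 𝓘(ℝ, Fin m → ℂ) := by
  rw [contDiffGroupoid, contDiffGroupoid]
  refine groupoid_of_pregroupoid_le _ _ fun f s hf => ?_
  have h : ContDiffOn ℂ ω f s := by simpa [contDiffPregroupoid, ContDiffOn] using hf
  have h' : ContDiffOn ℝ ∞ f s := (h.restrict_scalars ℝ).of_le le_top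
  simpa [contDiffPregroupoid, ContDiffOn] using h'

variable (m M) in
/-- The real smooth manifold underlying a complex manifold. -/
lemma isManifold_real [hM : IsManifold 𝓘(ℂ, Fin m → ℂ) ω M] :
    IsManifold 𝓘(ℝ, Fin m → ℂ) ∞ M :=
  { hM.toHasGroupoid with
    compatible := fun h h' => contDiffGroupoid_complex_le_real (hM.compatible h h') }

lemma mem_maximalAtlas_real {φ : OpenPartialHomeomorph M (Fin m → ℂ)}
    (hφ : φ ∈ IsManifold.maximalAtlas 𝓘(ℂ, Fin m → ℂ) ω M) :
    φ ∈ IsManifold.maximalAtlas 𝓘(ℝ, Fin m → ℂ) ∞ M :=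
  StructureGroupoid.maximalAtlas_mono contDiffGroupoid_complex_le_real hφ

lemma tangentMapAt_comp {h : M' → M''} {g : M → M'} {x : M}
    (hh : MDifferentiableAt 𝓘(ℂ, Fin m' → ℂ) 𝓘(ℂ, Fin m'' → ℂ) h (g x))
    (hg : MDifferentiableAt 𝓘(ℂ, Fin m → ℂ) 𝓘(ℂ, Fin m' → ℂ) g x) :
    tangentMapAt (m := m) (m' := m'') (h ∘ g) x =
      (tangentMapAt (m := m') (m' := m'') h (g x)).comp (tangentMapAt (m := m) (m' := m') g x) :=
  mfderiv_comp x hh hg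

lemma tangentMapAt_congr {g g' : M → M'} {x : M} (h : g =ᶠ[nhds x] g') :
    tangentMapAt (m := m) (m' := m') g x = tangentMapAt (m := m) (m' := m') g' x :=
  h.mfderiv_eq

lemma tangentMapAt_eq_fderiv (G : (Fin m → ℂ) → (Fin m' → ℂ)) (y : Fin m → ℂ) :
    tangentMapAt G y = fderiv ℂ G y :=
  mfderiv_eq_fderiv

lemma tangentMapAt_id (x : M) : tangentMapAt (m := m) (m' := m) (id : M → M) x = .id ℂ _ :=
  mfderiv_id

lemma differentialAt_comp {f : M' → ℂ} {g : M → M'} {x : M}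
    (hf : MDifferentiableAt 𝓘(ℂ, Fin m' → ℂ) 𝓘(ℂ, ℂ) f (g x))
    (hg : MDifferentiableAt 𝓘(ℂ, Fin m → ℂ) 𝓘(ℂ, Fin m' → ℂ) g x) :
    differentialAt (m := m) (f ∘ g) x =
      (differentialAt (m := m') f (g x)).comp (tangentMapAt (m := m) (m' := m') g x) :=
  mfderiv_comp x hf hg

lemma differentialAt_eq_fderiv (G : (Fin m → ℂ) → ℂ) (y : Fin m → ℂ) :
    differentialAt G y = fderiv ℂ G y :=
  mfderiv_eq_fderiv

/-- The tangent spaces are identified with the model space by means of the preferred charts. -/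
lemma tangentMapAt_chartAt_symm [IsManifold 𝓘(ℂ, Fin m → ℂ) ω M] (x : M) :
    tangentMapAt (m := m) (m' := m) (chartAt (Fin m → ℂ) x).symm (chartAt (Fin m → ℂ) x x) =
      .id ℂ _ := by
  refine HasMFDerivAt.mfderiv (I := 𝓘(ℂ, Fin m → ℂ)) (I' := 𝓘(ℂ, Fin m → ℂ)) ⟨?_, ?_⟩
  · exact (chartAt (Fin m → ℂ) x).continuousAt_symm (mem_chart_target _ x)
  · have h : writtenInExtChartAt 𝓘(ℂ, Fin m → ℂ) 𝓘(ℂ, Fin m → ℂ) (chartAt (Fin m → ℂ) x x)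
        (chartAt (Fin m → ℂ) x).symm =ᶠ[nhds (chartAt (Fin m → ℂ) x x)] id := by
      filter_upwards [(chartAt (Fin m → ℂ) x).open_target.mem_nhds (mem_chart_target _ x)] with y hy
      have hx := (chartAt (Fin m → ℂ) x).left_inv (mem_chart_source _ x)
      simp only [writtenInExtChartAt, hx]
      exact (chartAt (Fin m → ℂ) x).right_inv hy
    have h' := (hasFDerivAt_id (𝕜 := ℂ) (chartAt (Fin m → ℂ) x x)).congr_of_eventuallyEq h
    exact h'.hasFDerivWithinAt

/-- The expression of a map in two charts. -/
noncomputable def coordMap (g : M → M') (φ : OpenPartialHomeomorph M (Fin m → ℂ))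
    (χ : OpenPartialHomeomorph M' (Fin m' → ℂ)) : (Fin m → ℂ) → (Fin m' → ℂ) :=
  fun y => χ (g (φ.symm y))

section CoordMap

variable [IsManifold 𝓘(ℂ, Fin m → ℂ) ω M] [IsManifold 𝓘(ℂ, Fin m' → ℂ) ω M'] {g : M → M'}
  (hg : MDifferentiable 𝓘(ℂ, Fin m → ℂ) 𝓘(ℂ, Fin m' → ℂ) g)
  {φ : OpenPartialHomeomorph M (Fin m → ℂ)}
  (hφ : φ ∈ IsManifold.maximalAtlas 𝓘(ℂ, Fin m → ℂ) ω M)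
  {χ : OpenPartialHomeomorph M' (Fin m' → ℂ)}
  (hχ : χ ∈ IsManifold.maximalAtlas 𝓘(ℂ, Fin m' → ℂ) ω M')

omit [IsManifold 𝓘(ℂ, Fin m → ℂ) ω M] [IsManifold 𝓘(ℂ, Fin m' → ℂ) ω M'] in
include hg in
lemma isOpen_coordMap_domain : IsOpen {y | y ∈ φ.target ∧ g (φ.symm y) ∈ χ.source} :=
  (hg.continuous.comp_continuousOn φ.continuousOn_symm).isOpen_inter_preimage φ.open_target
    χ.open_source

include hg hφ hχ

omit [IsManifold 𝓘(ℂ, Fin m → ℂ) ω M] [IsManifold 𝓘(ℂ, Fin m' → ℂ) ω M'] in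
lemma differentiableAt_coordMap {y : Fin m → ℂ} (hy : y ∈ φ.target)
    (hy' : g (φ.symm y) ∈ χ.source) : DifferentiableAt ℂ (coordMap g φ χ) y := by
  rw [← mdifferentiableAt_iff_differentiableAt]
  exact (contMDiffAt_of_mem_maximalAtlas hχ hy').mdifferentiableAt (by simp) |>.comp y
    ((hg (φ.symm y)).comp y ((contMDiffAt_symm_of_mem_maximalAtlas hφ hy).mdifferentiableAt (by simp)))

omit [IsManifold 𝓘(ℂ, Fin m → ℂ) ω M] [IsManifold 𝓘(ℂ, Fin m' → ℂ) ω M'] in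
lemma contDiffAt_coordMap {y : Fin m → ℂ} (hy : y ∈ φ.target)
    (hy' : g (φ.symm y) ∈ χ.source) : ContDiffAt ℂ ω (coordMap g φ χ) y := by
  refine AnalyticAt.contDiffAt (DifferentiableOn.analyticAt_of_finiteDimensional
    (isOpen_coordMap_domain hg) (fun z hz => ?_) (⟨hy, hy'⟩ : y ∈
      {y | y ∈ φ.target ∧ g (φ.symm y) ∈ χ.source}))
  exact (differentiableAt_coordMap hg hφ hχ hz.1 hz.2).differentiableWithinAt

omit [IsManifold 𝓘(ℂ, Fin m → ℂ) ω M] [IsManifold 𝓘(ℂ, Fin m' → ℂ) ω M'] in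
-- Both sides are the derivative of `g ∘ φ.symm`, by the chain rule.
lemma tangentMapAt_symm_comp_coordMap {y : Fin m → ℂ} (hy : y ∈ φ.target)
    (hy' : g (φ.symm y) ∈ χ.source) :
    (tangentMapAt (m := m') (m' := m') χ.symm (coordMap g φ χ y)).comp
        (fderiv ℂ (coordMap g φ χ) y) =
      (tangentMapAt (m := m) (m' := m') g (φ.symm y)).comp
        (tangentMapAt (m := m) (m' := m) φ.symm y) := by
  rw [← tangentMapAt_eq_fderiv, ← tangentMapAt_comp (g := coordMap g φ χ) (h := χ.symm)
    ((contMDiffAt_symm_of_mem_maximalAtlas hχ (χ.map_source hy')).mdifferentiableAt (by simp))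
    (differentiableAt_coordMap hg hφ hχ hy hy').mdifferentiableAt,
    ← tangentMapAt_comp (hg _) ((contMDiffAt_symm_of_mem_maximalAtlas hφ hy).mdifferentiableAt (by simp))]
  refine tangentMapAt_congr ?_
  filter_upwards [(isOpen_coordMap_domain hg).mem_nhds
    (⟨hy, hy'⟩ : y ∈ {y | y ∈ φ.target ∧ g (φ.symm y) ∈ χ.source})] with z hz
  exact χ.left_inv hz.2

omit [IsManifold 𝓘(ℂ, Fin m → ℂ) ω M] [IsManifold 𝓘(ℂ, Fin m' → ℂ) ω M'] in
/-- The coordinate expression of a pull-back. -/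
lemma coordForm_pullbackForm {k : ℕ} (α : FormField m' M' k) {y : Fin m → ℂ} (hy : y ∈ φ.target)
    (hy' : g (φ.symm y) ∈ χ.source) :
    coordForm (pullbackForm g α) φ y =
      (coordForm α χ (coordMap g φ χ y)).compContinuousLinearMap
        (fderiv ℝ (coordMap g φ χ) y) := by
  have h := tangentMapAt_symm_comp_coordMap hg hφ hχ hy hy'
  rw [(differentiableAt_coordMap hg hφ hχ hy hy').fderiv_restrictScalars ℝ]
  ext v
  have h1 : χ.symm (coordMap g φ χ y) = g (φ.symm y) := χ.left_inv hy'
  simp only [coordForm, pullbackForm, ContinuousAlternatingMap.compContinuousLinearMap_apply, h1]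
  congr 1
  funext i
  exact (DFunLike.congr_fun h (v i)).symm

end CoordMap

section Forms

variable [IsManifold 𝓘(ℂ, Fin m → ℂ) ω M] [IsManifold 𝓘(ℂ, Fin m' → ℂ) ω M'] {k : ℕ}

omit [IsManifold 𝓘(ℂ, Fin m → ℂ) ω M] in
lemma pullbackForm_id (α : FormField m M k) : pullbackForm (m := m) (id : M → M) α = α := by
  funext x
  ext v
  simp [pullbackForm, tangentMapAt_id]

omit [IsManifold 𝓘(ℂ, Fin m → ℂ) ω M] in
-- A change of charts is the coordinate expression of the identity, so the transformation rule for
-- pull-backs gives `α` in the chart `φ` from `α` in the chart `χ`.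
lemma contDiffAt_coordForm_of_chart {α : FormField m M k}
    {φ χ : OpenPartialHomeomorph M (Fin m → ℂ)}
    (hφ : φ ∈ IsManifold.maximalAtlas 𝓘(ℂ, Fin m → ℂ) ω M)
    (hχ : χ ∈ IsManifold.maximalAtlas 𝓘(ℂ, Fin m → ℂ) ω M) {x : M} (hx : x ∈ φ.source)
    (hx' : x ∈ χ.source) (h : ContDiffAt ℝ ∞ (coordForm α χ) (χ x)) :
    ContDiffAt ℝ ∞ (coordForm α φ) (φ x) := by
  have hid : MDifferentiable 𝓘(ℂ, Fin m → ℂ) 𝓘(ℂ, Fin m → ℂ) (id : M → M) := mdifferentiable_id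
  have hy : φ x ∈ φ.target := φ.map_source hx
  have hy' : id (φ.symm (φ x)) ∈ χ.source := by simpa [φ.left_inv hx] using hx'
  have hc : ContDiffAt ℝ ∞ (coordMap id φ χ) (φ x) :=
    ((contDiffAt_coordMap hid hφ hχ hy hy').restrict_scalars ℝ).of_le le_top
  have hG : coordMap id φ χ (φ x) = χ x := by simp [coordMap, φ.left_inv hx]
  have hev : coordForm α φ =ᶠ[nhds (φ x)] fun y =>
      (coordForm α χ (coordMap id φ χ y)).compContinuousLinearMap
        (fderiv ℝ (coordMap id φ χ) y) := by
    filter_upwards [(isOpen_coordMap_domain hid).mem_nhds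
      (⟨hy, hy'⟩ : φ x ∈ {y | y ∈ φ.target ∧ id (φ.symm y) ∈ χ.source})] with z hz
    rw [← coordForm_pullbackForm hid hφ hχ α hz.1 hz.2, pullbackForm_id]
  refine ContDiffAt.congr_of_eventuallyEq (ContDiffAt.compContinuousLinearMap ?_ ?_) hev
  · exact ContDiffAt.comp (φ x) (by rwa [hG]) hc
  · exact hc.fderiv_right (by simp)

lemma contDiffAt_coordForm {α : FormField m M k} (hα : α ∈ smoothForms m M k)
    {φ : OpenPartialHomeomorph M (Fin m → ℂ)}
    (hφ : φ ∈ IsManifold.maximalAtlas 𝓘(ℂ, Fin m → ℂ) ω M) {y : Fin m → ℂ} (hy : y ∈ φ.target) :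
    ContDiffAt ℝ ∞ (coordForm α φ) y := by
  have h := contDiffAt_coordForm_of_chart hφ
    (IsManifold.chart_mem_maximalAtlas (I := 𝓘(ℂ, Fin m → ℂ)) (n := ω) (φ.symm y))
    (φ.map_target hy) (mem_chart_source _ (φ.symm y))
    ((hα _ (chart_mem_atlas _ _)).contDiffAt ((chartAt (Fin m → ℂ) (φ.symm y)).open_target.mem_nhds
      (mem_chart_target _ _)))
  rwa [φ.right_inv hy] at h

lemma mem_smoothForms_of_forall_exists_chart {α : FormField m M k}
    (h : ∀ x, ∃ χ ∈ IsManifold.maximalAtlas 𝓘(ℂ, Fin m → ℂ) ω M, x ∈ χ.source ∧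
      ContDiffAt ℝ ∞ (coordForm α χ) (χ x)) : α ∈ smoothForms m M k := by
  intro φ hφ y hy
  obtain ⟨χ, hχ, hx, hc⟩ := h (φ.symm y)
  have := contDiffAt_coordForm_of_chart (IsManifold.subset_maximalAtlas hφ) hχ (φ.map_target hy) hx hc
  rw [φ.right_inv hy] at this
  exact this.contDiffWithinAt

section Pullback

variable {g : M → M'} (hg : MDifferentiable 𝓘(ℂ, Fin m → ℂ) 𝓘(ℂ, Fin m' → ℂ) g)
include hg

omit [IsManifold 𝓘(ℂ, Fin m → ℂ) ω M] [IsManifold 𝓘(ℂ, Fin m' → ℂ) ω M'] in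
lemma coordForm_pullbackForm_eventuallyEq (α : FormField m' M' k)
    {φ : OpenPartialHomeomorph M (Fin m → ℂ)}
    (hφ : φ ∈ IsManifold.maximalAtlas 𝓘(ℂ, Fin m → ℂ) ω M)
    {χ : OpenPartialHomeomorph M' (Fin m' → ℂ)}
    (hχ : χ ∈ IsManifold.maximalAtlas 𝓘(ℂ, Fin m' → ℂ) ω M')
    {y : Fin m → ℂ} (hy : y ∈ φ.target) (hy' : g (φ.symm y) ∈ χ.source) :
    coordForm (pullbackForm g α) φ =ᶠ[nhds y] fun y =>
      (coordForm α χ (coordMap g φ χ y)).compContinuousLinearMap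
        (fderiv ℝ (coordMap g φ χ) y) := by
  filter_upwards [(isOpen_coordMap_domain hg).mem_nhds
    (⟨hy, hy'⟩ : y ∈ {y | y ∈ φ.target ∧ g (φ.symm y) ∈ χ.source})] with z hz
  exact coordForm_pullbackForm hg hφ hχ α hz.1 hz.2

lemma pullbackForm_mem_smoothForms {α : FormField m' M' k} (hα : α ∈ smoothForms m' M' k) :
    pullbackForm g α ∈ smoothForms m M k := by
  refine mem_smoothForms_of_forall_exists_chart fun x =>
    ⟨chartAt _ x, IsManifold.chart_mem_maximalAtlas x, mem_chart_source _ x, ?_⟩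
  have hφ := IsManifold.chart_mem_maximalAtlas (I := 𝓘(ℂ, Fin m → ℂ)) (n := ω) x
  have hχ := IsManifold.chart_mem_maximalAtlas (I := 𝓘(ℂ, Fin m' → ℂ)) (n := ω) (g x)
  set φ := chartAt (Fin m → ℂ) x
  set χ := chartAt (Fin m' → ℂ) (g x)
  have hx : x ∈ φ.source := mem_chart_source _ x
  have hy : φ x ∈ φ.target := φ.map_source hx
  have hy' : g (φ.symm (φ x)) ∈ χ.source := by
    rw [φ.left_inv hx]; exact mem_chart_source _ (g x)
  have hc : ContDiffAt ℝ ∞ (coordMap g φ χ) (φ x) :=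
    ((contDiffAt_coordMap hg hφ hχ hy hy').restrict_scalars ℝ).of_le le_top
  refine ContDiffAt.congr_of_eventuallyEq (ContDiffAt.compContinuousLinearMap ?_ ?_)
    (coordForm_pullbackForm_eventuallyEq hg α hφ hχ hy hy')
  · exact ContDiffAt.comp (φ x) (contDiffAt_coordForm hα hχ (χ.map_source hy')) hc
  · exact hc.fderiv_right (by simp)

omit [IsManifold 𝓘(ℂ, Fin m → ℂ) ω M] in
/-- The exterior derivative commutes with pull-backs. -/
lemma extDeriv_coordForm_pullbackForm {α : FormField m' M' k} (hα : α ∈ smoothForms m' M' k)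
    {φ : OpenPartialHomeomorph M (Fin m → ℂ)}
    (hφ : φ ∈ IsManifold.maximalAtlas 𝓘(ℂ, Fin m → ℂ) ω M) {y : Fin m → ℂ} (hy : y ∈ φ.target) :
    extDeriv (coordForm (pullbackForm g α) φ) y =
      coordForm (pullbackForm g (extDerivForm α)) φ y := by
  have hχ := IsManifold.chart_mem_maximalAtlas (I := 𝓘(ℂ, Fin m' → ℂ)) (n := ω) (g (φ.symm y))
  have hy' : g (φ.symm y) ∈ (chartAt (Fin m' → ℂ) (g (φ.symm y))).source := mem_chart_source _ _
  have hc := (contDiffAt_coordMap hg hφ hχ hy hy').restrict_scalars ℝ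
  have h := tangentMapAt_symm_comp_coordMap hg hφ hχ hy hy'
  -- In the preferred chart at the image point the tangent identification is the identity, so the
  -- exterior derivative computed there is `extDerivForm α` itself.
  rw [coordMap, tangentMapAt_chartAt_symm, ContinuousLinearMap.id_comp] at h
  rw [(coordForm_pullbackForm_eventuallyEq hg α hφ hχ hy hy').extDeriv_eq,
    extDeriv_pullback (f := coordMap g φ (chartAt (Fin m' → ℂ) (g (φ.symm y))))
      ((contDiffAt_coordForm hα hχ (OpenPartialHomeomorph.map_source _ hy')).differentiableAt
        (by simp)) hc le_top, (differentiableAt_coordMap hg hφ hχ hy hy').fderiv_restrictScalars ℝ]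
  ext v
  simp only [coordForm, pullbackForm, ContinuousAlternatingMap.compContinuousLinearMap_apply]
  refine congrArg _ (funext fun i => ?_)
  exact DFunLike.congr_fun h (v i)

end Pullback

end Forms

end ComplexManifold

/-! ### Charts having the submersion as first coordinate. -/

section AdaptedCharts

variable {n : ℕ} {Z : Type*} [TopologicalSpace Z] [ChartedSpace (Fin (n + 1) → ℂ) Z]

/-- Holomorphic charts whose first coordinate is `f`. -/
structure IsAdaptedChart (f : Z → ℂ) (φ : OpenPartialHomeomorph Z (Fin (n + 1) → ℂ)) : Prop where
  mem_maximalAtlas : φ ∈ IsManifold.maximalAtlas 𝓘(ℂ, Fin (n + 1) → ℂ) ω Z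
  apply_zero : ∀ z ∈ φ.source, φ z 0 = f z

/-- A linear form on `ℂ ^ (n + 1)` which does not vanish is the first coordinate in some linear
coordinate system. -/
lemma exists_continuousLinearEquiv_apply_zero (l : (Fin (n + 1) → ℂ) →L[ℂ] ℂ)
    {k : Fin (n + 1)} (hl : l (Pi.single k 1) ≠ 0) :
    ∃ A : (Fin (n + 1) → ℂ) ≃L[ℂ] (Fin (n + 1) → ℂ), ∀ x i,
      A x i = if i = 0 then l x else x (Equiv.swap 0 k i) := by
  let A : (Fin (n + 1) → ℂ) →ₗ[ℂ] (Fin (n + 1) → ℂ) :=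
    LinearMap.pi fun i => if i = 0 then l.toLinearMap else LinearMap.proj (Equiv.swap 0 k i)
  have hA : ∀ x i, A x i = if i = 0 then l x else x (Equiv.swap 0 k i) := fun x i => by
    by_cases hi : i = 0 <;> simp [A, hi]
  have hinj : Function.Injective A := by
    rw [← LinearMap.ker_eq_bot, LinearMap.ker_eq_bot']
    intro x hx
    have h1 : ∀ j, j ≠ k → x j = 0 := fun j hj => by
      have h2 := congrFun hx (Equiv.swap 0 k j)
      have h3 : Equiv.swap 0 k j ≠ 0 := by
        intro h
        apply hj
        have := congrArg (Equiv.swap 0 k) h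
        rwa [Equiv.swap_apply_self, Equiv.swap_apply_left] at this
      rw [hA, if_neg h3, Equiv.swap_apply_self] at h2
      exact h2
    have h2 : x = x k • Pi.single k 1 := by
      funext j
      by_cases hj : j = k
      · subst hj; simp
      · simp [h1 j hj, hj]
    have h3 := congrFun hx 0
    rw [hA, if_pos rfl, h2, map_smul] at h3
    have h4 : x k = 0 := by simpa [hl] using h3
    rw [h2, h4, zero_smul]
  exact ⟨(LinearEquiv.ofInjectiveEndo A hinj).toContinuousLinearEquiv, fun x i => hA x i⟩

variable [IsManifold 𝓘(ℂ, Fin (n + 1) → ℂ) ω Z]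

/-- Around each point where `f` is a submersion there is a chart adapted to `f`. -/
lemma exists_isAdaptedChart {f : Z → ℂ}
    (hf : MDifferentiable 𝓘(ℂ, Fin (n + 1) → ℂ) 𝓘(ℂ, ℂ) f) (z : Z)
    (hz : Function.Surjective (differentialAt (m := n + 1) f z)) :
    ∃ φ : OpenPartialHomeomorph Z (Fin (n + 1) → ℂ), IsAdaptedChart f φ ∧ z ∈ φ.source := by
  have hχ := IsManifold.chart_mem_maximalAtlas (I := 𝓘(ℂ, Fin (n + 1) → ℂ)) (n := ω) z
  have hzχ : z ∈ (chartAt (Fin (n + 1) → ℂ) z).source := mem_chart_source _ z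
  have hid := tangentMapAt_chartAt_symm (m := n + 1) z
  set χ := chartAt (Fin (n + 1) → ℂ) z
  set F : (Fin (n + 1) → ℂ) → ℂ := f ∘ χ.symm with hF
  have hFd : DifferentiableOn ℂ F χ.target := fun y hy => by
    have : MDifferentiableAt 𝓘(ℂ, Fin (n + 1) → ℂ) 𝓘(ℂ, ℂ) F y :=
      (hf _).comp y ((contMDiffAt_symm_of_mem_maximalAtlas hχ hy).mdifferentiableAt (by simp))
    exact (mdifferentiableAt_iff_differentiableAt.1 this).differentiableWithinAt
  have hFa : ∀ y ∈ χ.target, AnalyticAt ℂ F y := fun y hy =>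
    hFd.analyticAt_of_finiteDimensional χ.open_target hy
  have hy₀ : χ z ∈ χ.target := χ.map_source hzχ
  have hl : Function.Surjective (fderiv ℂ F (χ z)) := by
    rw [← differentialAt_eq_fderiv, hF, differentialAt_comp (hf _)
      ((contMDiffAt_symm_of_mem_maximalAtlas hχ hy₀).mdifferentiableAt (by simp)), hid,
      χ.left_inv hzχ, ContinuousLinearMap.comp_id]
    exact hz
  obtain ⟨k, hk⟩ : ∃ k, fderiv ℂ F (χ z) (Pi.single k 1) ≠ 0 := by
    by_contra! h
    obtain ⟨v, hv⟩ := hl 1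
    have : fderiv ℂ F (χ z) = 0 := by
      apply ContinuousLinearMap.coe_injective
      refine LinearMap.pi_ext' fun i => LinearMap.ext_ring ?_
      simpa using h i
    rw [this] at hv
    simp at hv
  obtain ⟨A, hA⟩ := exists_continuousLinearEquiv_apply_zero _ hk
  -- The coordinate `k`, along which `F` has nonzero derivative, is replaced by `F`, which is put in
  -- position 0 by the swap.
  let Ψ : (Fin (n + 1) → ℂ) → (Fin (n + 1) → ℂ) := fun y i =>
    if i = 0 then F y else y (Equiv.swap 0 k i)
  have hΨa : ∀ y ∈ χ.target, ContDiffAt ℂ ω Ψ y := fun y hy => by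
    refine contDiffAt_pi.2 fun i => ?_
    by_cases hi : i = 0
    · simpa [Ψ, hi] using (hFa y hy).contDiffAt
    · simp only [Ψ, if_neg hi]
      exact (ContinuousLinearMap.proj (R := ℂ) (φ := fun _ => ℂ) (Equiv.swap 0 k i)).contDiff.contDiffAt
  have hΨA : HasFDerivAt Ψ (A : (Fin (n + 1) → ℂ) →L[ℂ] (Fin (n + 1) → ℂ)) (χ z) := by
    refine hasFDerivAt_pi'.2 fun i => ?_
    by_cases hi : i = 0
    · have h1 : (ContinuousLinearMap.proj i).comp
          (A : (Fin (n + 1) → ℂ) →L[ℂ] (Fin (n + 1) → ℂ)) = fderiv ℂ F (χ z) := by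
        ext1 x
        simpa [hi] using hA x i
      rw [h1]
      simpa [Ψ, hi] using (hFa _ hy₀).differentiableAt.hasFDerivAt
    · have h1 : (ContinuousLinearMap.proj i).comp
          (A : (Fin (n + 1) → ℂ) →L[ℂ] (Fin (n + 1) → ℂ)) =
            ContinuousLinearMap.proj (R := ℂ) (φ := fun _ => ℂ) (Equiv.swap 0 k i) := by
        ext1 x
        simpa [hi] using hA x i
      rw [h1]
      simp only [Ψ, if_neg hi]
      exact hasFDerivAt_apply _ _
  set e := (hΨa _ hy₀).toOpenPartialHomeomorph Ψ hΨA (by simp) with he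
  have hecoe : (e : (Fin (n + 1) → ℂ) → (Fin (n + 1) → ℂ)) = Ψ := rfl
  -- the points where the derivative is invertible
  have hcont : ContinuousOn (fderiv ℂ Ψ) χ.target := fun y hy =>
    ((hΨa y hy).fderiv_right (m := 0) (by simp)).continuousAt.continuousWithinAt
  let S : Set (Fin (n + 1) → ℂ) := χ.target ∩ (fderiv ℂ Ψ) ⁻¹'
    Set.range ((↑) : ((Fin (n + 1) → ℂ) ≃L[ℂ] (Fin (n + 1) → ℂ)) → _)
  have hS : IsOpen S := hcont.isOpen_inter_preimage χ.open_target ContinuousLinearEquiv.isOpen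
  have hzS : χ z ∈ S := ⟨hy₀, A, hΨA.fderiv.symm⟩
  -- The inverse must be analytic on the whole target, not just near one point; on `S` the inverse
  -- function theorem applies everywhere.
  let e' := e.restrOpen S hS
  let φ := χ.trans e'
  have hsrc : ∀ x, x ∈ φ.source ↔ x ∈ χ.source ∧ χ x ∈ e.source ∧ χ x ∈ S := fun x => by
    simp [φ, e']
  refine ⟨φ, ⟨?_, fun x hx => ?_⟩, ?_⟩
  · refine OpenPartialHomeomorph.mem_maximalAtlas_of_contMDiffOn φ ?_ ?_
    · intro x hx
      obtain ⟨h1, h2, h3⟩ := (hsrc x).1 hx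
      exact (ContMDiffAt.comp x ((hΨa _ h3.1).contMDiffAt)
        (contMDiffAt_of_mem_maximalAtlas hχ h1)).contMDiffWithinAt
    · intro y hy
      have hy1 : y ∈ e'.target ∧ e'.symm y ∈ χ.target := by
        have := hy
        rwa [OpenPartialHomeomorph.trans_target] at this
      have hy2 : e'.symm y ∈ e.source ∩ S := by
        have := e'.map_target hy1.1
        rwa [OpenPartialHomeomorph.restrOpen_source] at this
      obtain ⟨B, hB⟩ := hy2.2.2
      have h1 : ContDiffAt ℂ ω e'.symm y :=
        e'.contDiffAt_symm hy1.1 (f₀' := B)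
          (by rw [hB]; exact ((hΨa _ hy1.2).differentiableAt (by simp)).hasFDerivAt) (hΨa _ hy1.2)
      exact (ContMDiffAt.comp y (contMDiffAt_symm_of_mem_maximalAtlas hχ hy1.2)
        h1.contMDiffAt).contMDiffWithinAt
  · exact congrArg f (χ.left_inv ((hsrc x).1 hx).1)
  · exact (hsrc z).2 ⟨hzχ, ContDiffAt.mem_toOpenPartialHomeomorph_source _ _ _, hzS⟩

end AdaptedCharts

/-! ### Compactness from properness. -/

section Compactness

lemma isCompact_preimage_of_isProperMap_codRestrict {Z : Type*} [TopologicalSpace Z]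
    {f : Z → ℂ} {U : Set ℂ} (hfU : ∀ z, f z ∈ U) (hp : IsProperMap (Set.codRestrict f U hfU))
    {K : Set ℂ} (hK : IsCompact K) (hKU : K ⊆ U) : IsCompact (f ⁻¹' K) := by
  have h1 : f ⁻¹' K = Set.codRestrict f U hfU ⁻¹' (Subtype.val ⁻¹' K) := rfl
  rw [h1]
  refine hp.isCompact_preimage ?_
  rw [Subtype.isCompact_iff, Subtype.image_preimage_coe, Set.inter_eq_right.2 hKU]
  exact hK

/-- No countability is assumed on the total space; properness over a σ-compact base supplies what
partitions of unity require. -/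
lemma sigmaCompactSpace_of_isProperMap_codRestrict {Z : Type*} [TopologicalSpace Z]
    {f : Z → ℂ} {U : Set ℂ} (hU : IsOpen U) (hfU : ∀ z, f z ∈ U)
    (hp : IsProperMap (Set.codRestrict f U hfU)) : SigmaCompactSpace Z := by
  have : LocallyCompactSpace U := hU.locallyCompactSpace
  refine ⟨⟨fun k => Set.codRestrict f U hfU ⁻¹' compactCovering U k, fun k =>
    hp.isCompact_preimage (isCompact_compactCovering U k), ?_⟩⟩
  rw [← Set.preimage_iUnion, iUnion_compactCovering, Set.preimage_univ]

end Compactness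

/-! ### Partitions of unity in adapted charts. -/

section Partition

variable {n : ℕ} {Z : Type*} [TopologicalSpace Z] [T2Space Z] [ChartedSpace (Fin (n + 1) → ℂ) Z]
  [IsManifold 𝓘(ℂ, Fin (n + 1) → ℂ) ω Z]

/-- A smooth partition of unity with compact supports in charts adapted to a submersion. -/
lemma exists_smoothPartitionOfUnity_isAdaptedChart [SigmaCompactSpace Z] {f : Z → ℂ}
    (hf : MDifferentiable 𝓘(ℂ, Fin (n + 1) → ℂ) 𝓘(ℂ, ℂ) f)
    (hfs : ∀ z, Function.Surjective (differentialAt (m := n + 1) f z)) :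
    ∃ (ρ : SmoothPartitionOfUnity Z 𝓘(ℝ, Fin (n + 1) → ℂ) Z Set.univ)
      (φ : Z → OpenPartialHomeomorph Z (Fin (n + 1) → ℂ)), ∀ z, IsAdaptedChart f (φ z) ∧
        tsupport (ρ z) ⊆ (φ z).source ∧ HasCompactSupport (ρ z) := by
  have := isManifold_real (n + 1) Z
  have : LocallyCompactSpace Z := ChartedSpace.locallyCompactSpace (Fin (n + 1) → ℂ) Z
  choose φ hφ hz using fun z => exists_isAdaptedChart hf z (hfs z)
  choose K hK hzK hKφ using fun z => exists_compact_subset (φ z).open_source (hz z)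
  obtain ⟨ρ, hρ⟩ := SmoothPartitionOfUnity.exists_isSubordinate 𝓘(ℝ, Fin (n + 1) → ℂ)
    (isClosed_univ (X := Z)) (fun z => interior (K z)) (fun z => isOpen_interior)
    (fun z _ => Set.mem_iUnion.2 ⟨z, hzK z⟩)
  refine ⟨ρ, φ, fun z => ⟨hφ z, (hρ z).trans (interior_subset.trans (hKφ z)), ?_⟩⟩
  exact (hK z).of_isClosed_subset (isClosed_tsupport _) ((hρ z).trans interior_subset)

/-- Smooth adapted partitions exist on compact sets. -/
lemma exists_adaptedPartition_contMDiff [SigmaCompactSpace Z] {f : Z → ℂ}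
    (hf : MDifferentiable 𝓘(ℂ, Fin (n + 1) → ℂ) 𝓘(ℂ, ℂ) f)
    (hfs : ∀ z, Function.Surjective (differentialAt (m := n + 1) f z)) {K : Set Z}
    (hK : IsCompact K) :
    ∃ P : AdaptedPartition (n := n) f K,
      ∀ j, ContMDiff 𝓘(ℝ, Fin (n + 1) → ℂ) 𝓘(ℝ, ℝ) ∞ (P.weight j) := by
  obtain ⟨ρ, φ, h⟩ := exists_smoothPartitionOfUnity_isAdaptedChart hf hfs
  have hfin := ρ.locallyFinite.finite_nonempty_inter_compact hK
  let e := hfin.toFinset.equivFin.symm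
  refine ⟨{ card := hfin.toFinset.card
            chart := fun j => φ (e j)
            chart_mem := fun j => (h _).1.mem_maximalAtlas
            chart_zero := fun j => (h _).1.apply_zero
            weight := fun j => ρ (e j)
            continuous_weight := fun j => (ρ _).contMDiff.continuous
            hasCompactSupport_weight := fun j => (h _).2.2
            tsupport_subset := fun j => (h _).2.1
            sum_weight := fun z hz => ?_ }, fun j => (ρ _).contMDiff⟩
  rw [e.sum_comp (fun i => ρ i z), Finset.sum_coe_sort hfin.toFinset (fun i => ρ i z)]
  have h1 := ρ.sum_eq_one (Set.mem_univ z)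
  rwa [finsum_eq_sum_of_support_subset _ (s := hfin.toFinset)] at h1
  intro i hi
  simp only [Set.Finite.coe_toFinset, Set.mem_ofPred_eq]
  exact ⟨z, hi, hz⟩

end Partition

/-! ### Forms of top degree and determinants. -/

section TopDegree

variable {V : Type*} [AddCommGroup V] [Module ℝ V]

/-- An alternating map of top degree is multiplied by the determinant under linear changes of the
arguments. -/
lemma AlternatingMap.map_comp_eq_det_mul {d : ℕ} [Module.Finite ℝ V]
    (hd : Module.finrank ℝ V = d)
    (A : V [⋀^Fin d]→ₗ[ℝ] ℂ) (L : V →ₗ[ℝ] V) (v : Fin d → V) :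
    A (fun i => L (v i)) = (LinearMap.det L : ℝ) * A v := by
  let b := Module.finBasisOfFinrankEq ℝ V hd
  have key : ∀ B : V [⋀^Fin d]→ₗ[ℝ] ℝ, B (fun i => L (v i)) = LinearMap.det L * B v := fun B => by
    rw [B.eq_smul_basis_det b]
    have h := b.det_comp L v
    simp only [AlternatingMap.smul_apply, smul_eq_mul]
    rw [show (fun i => L (v i)) = L ∘ v from rfl, h]
    ring
  have hre := key (Complex.reLm.compAlternatingMap A)
  have him := key (Complex.imLm.compAlternatingMap A)
  simp only [LinearMap.compAlternatingMap_apply, Complex.reLm_coe, Complex.imLm_coe] at hre him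
  apply Complex.ext
  · rw [hre, Complex.re_ofReal_mul]
  · rw [him, Complex.im_ofReal_mul]

/-- Holomorphic coordinate changes have nonnegative real Jacobian, so the absolute value in the
change of variables formula creates no sign. -/
lemma det_restrictScalars_eq_normSq {m : ℕ} (L : (Fin m → ℂ) →ₗ[ℂ] (Fin m → ℂ)) :
    LinearMap.det (L.restrictScalars ℝ) = Complex.normSq (LinearMap.det L) := by
  rw [LinearMap.det_restrictScalars, Algebra.norm_complex_apply]

lemma finrank_real_fin_complex (m : ℕ) : Module.finrank ℝ (Fin m → ℂ) = 2 * m := by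
  rw [Module.finrank_pi_fintype]
  simp [Complex.finrank_real_complex, mul_comm]

/-- The degree is a separate variable because `2 * n + 1 + 1` has to be allowed for `2 * (n + 1)`.
-/
lemma ContinuousAlternatingMap.map_complexLinear_eq_normSq_det_mul {m d : ℕ} (hd : d = 2 * m)
    (A : (Fin m → ℂ) [⋀^Fin d]→L[ℝ] ℂ) (L : (Fin m → ℂ) →ₗ[ℂ] (Fin m → ℂ))
    (v : Fin d → Fin m → ℂ) :
    A (fun i => L (v i)) = (Complex.normSq (LinearMap.det L) : ℝ) * A v := by
  rw [← det_restrictScalars_eq_normSq]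
  exact AlternatingMap.map_comp_eq_det_mul (by rw [finrank_real_fin_complex, hd])
    A.toAlternatingMap (L.restrictScalars ℝ) v

end TopDegree

/-! ### Divisibility by a linear form, for reasons of type. -/

section HodgeType

variable {n : ℕ}

/-- The exterior product of a complex linear form and an alternating form. -/
noncomputable def wedgeLinear {m k : ℕ} (l : (Fin m → ℂ) →L[ℂ] ℂ)
    (B : (Fin m → ℂ) [⋀^Fin k]→L[ℝ] ℂ) : (Fin m → ℂ) [⋀^Fin (k + 1)]→L[ℝ] ℂ :=
  ContinuousAlternatingMap.alternatizeUncurryFin ((l.restrictScalars ℝ).smulRight B)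

lemma wedgeLinear_apply {m k : ℕ} (l : (Fin m → ℂ) →L[ℂ] ℂ)
    (B : (Fin m → ℂ) [⋀^Fin k]→L[ℝ] ℂ) (v : Fin (k + 1) → Fin m → ℂ) :
    wedgeLinear l B v = ∑ i : Fin (k + 1), (-1) ^ (i : ℕ) * l (v i) * B (i.removeNth v) := by
  rw [wedgeLinear, ContinuousAlternatingMap.alternatizeUncurryFin_apply]
  refine Finset.sum_congr rfl fun i _ => ?_
  simp [mul_assoc]

/-- The product has type `(a + 1, b)` with `a + 1 > b`. Multiplying all vectors by `c` with `‖c‖ =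
1` multiplies it by `c ^ (a + 1 - b)`, yet a form of top degree is unchanged because the real
determinant of this rotation is 1. A `c` for which the factor is `-1` forces the form to vanish. -/
lemma wedgeLinear_eq_zero_of_mem_formsOfType {a b : ℕ} (ha : n + 1 ≤ a) (hab : a + b = 2 * n + 1)
    (l : (Fin (n + 1) → ℂ) →L[ℂ] ℂ) {B : (Fin (n + 1) → ℂ) [⋀^Fin (2 * n + 1)]→L[ℝ] ℂ}
    (hB : B ∈ formsOfType (n + 1) (2 * n + 1) a b) : wedgeLinear l B = 0 := by
  ext v
  obtain ⟨d, hd, hd0⟩ : ∃ d, a + 1 = b + d ∧ d ≠ 0 := ⟨a + 1 - b, by omega, by omega⟩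
  -- a complex number of modulus one with `c ^ d = -1`
  set c : ℂ := Complex.exp ((Real.pi / d : ℝ) * Complex.I) with hc
  have hcd : c ^ d = -1 := by
    rw [hc, ← Complex.exp_nat_mul, ← Complex.exp_pi_mul_I]
    congr 1
    push_cast
    field_simp
  have hcn : ‖c‖ = 1 := Complex.norm_exp_ofReal_mul_I _
  have hcc : c * (starRingEnd ℂ) c = 1 := by
    rw [Complex.mul_conj, Complex.normSq_eq_norm_sq, hcn]; simp
  have h1 : wedgeLinear l B (fun i => c • v i) = -wedgeLinear l B v := by
    have h2 : c * (c ^ a * (starRingEnd ℂ) c ^ b) = -1 := by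
      calc c * (c ^ a * (starRingEnd ℂ) c ^ b) = c ^ (a + 1) * (starRingEnd ℂ) c ^ b := by ring
        _ = (c * (starRingEnd ℂ) c) ^ b * c ^ d := by rw [hd]; ring
        _ = -1 := by rw [hcc, hcd]; simp
    rw [wedgeLinear_apply, wedgeLinear_apply, ← Finset.sum_neg_distrib]
    refine Finset.sum_congr rfl fun i _ => ?_
    have h3 : (Fin.removeNth i fun i => c • v i) = fun j => c • Fin.removeNth i v j := rfl
    rw [h3, hB c, map_smul, smul_eq_mul]
    linear_combination ((-1) ^ (i : ℕ) * l (v i) * B (i.removeNth v)) * h2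
  have h2 := ContinuousAlternatingMap.map_complexLinear_eq_normSq_det_mul (m := n + 1)
    (d := 2 * n + 1 + 1) (by ring) (wedgeLinear l B) (c • LinearMap.id) v
  have h3 : Complex.normSq (LinearMap.det (c • (LinearMap.id : (Fin (n + 1) → ℂ) →ₗ[ℂ] _))) = 1 := by
    rw [LinearMap.det_smul, LinearMap.det_id, mul_one, map_pow, Complex.normSq_eq_norm_sq, hcn]
    simp
  rw [h3] at h2
  simp only [LinearMap.smul_apply, LinearMap.id_apply, Complex.ofReal_one, one_mul] at h2
  rw [h1] at h2
  have h4 : (2 : ℂ) * wedgeLinear l B v = 0 := by linear_combination -h2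
  simpa using h4

lemma wedgeLinear_eq_zero_of_mem_hodgeAlternating (l : (Fin (n + 1) → ℂ) →L[ℂ] ℂ)
    {B : (Fin (n + 1) → ℂ) [⋀^Fin (2 * n + 1)]→L[ℝ] ℂ}
    (hB : B ∈ hodgeAlternating (n + 1) (n + 1) (2 * n + 1)) : wedgeLinear l B = 0 := by
  let S : Submodule ℂ ((Fin (n + 1) → ℂ) [⋀^Fin (2 * n + 1)]→L[ℝ] ℂ) :=
    { carrier := {B | wedgeLinear l B = 0}
      zero_mem' := by ext v; simp [wedgeLinear_apply]
      add_mem' := fun {A B} hA hB => by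
        ext v
        have h1 := DFunLike.congr_fun hA v
        have h2 := DFunLike.congr_fun hB v
        rw [wedgeLinear_apply] at h1 h2 ⊢
        simp only [ContinuousAlternatingMap.add_apply, mul_add, Finset.sum_add_distrib, h1, h2]
        simp
      smul_mem' := fun t A hA => by
        ext v
        have h1 := DFunLike.congr_fun hA v
        rw [wedgeLinear_apply] at h1 ⊢
        simp only [ContinuousAlternatingMap.smul_apply, smul_eq_mul, mul_left_comm _ t,
          ← Finset.mul_sum, h1]
        simp }
  have h : hodgeAlternating (n + 1) (n + 1) (2 * n + 1) ≤ S := by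
    refine iSup₂_le fun a ha B hB => ?_
    rw [Finset.mem_Icc] at ha
    exact wedgeLinear_eq_zero_of_mem_formsOfType ha.1 (by omega) l hB
  exact h hB

/-- A form in `F^{n+1} Λ^{2n+1}` on `ℂ ^ (n + 1)` is divisible by any complex linear form `l`: it
is the product of `l` with its contraction by a vector `u` such that `l u = 1`. -/
lemma apply_eq_sum_of_mem_hodgeAlternating (l : (Fin (n + 1) → ℂ) →L[ℂ] ℂ)
    {B : (Fin (n + 1) → ℂ) [⋀^Fin (2 * n + 1)]→L[ℝ] ℂ}
    (hB : B ∈ hodgeAlternating (n + 1) (n + 1) (2 * n + 1)) {u : Fin (n + 1) → ℂ} (hu : l u = 1)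
    (w : Fin (2 * n + 1) → Fin (n + 1) → ℂ) :
    B w = ∑ i : Fin (2 * n + 1), (-1) ^ (i : ℕ) * l (w i) * B.curryLeft u (i.removeNth w) := by
  -- The vanishing product is evaluated on `u` followed by `w`; its term of index 0 is `B w`,
  -- because `l u = 1`.
  have h := DFunLike.congr_fun (wedgeLinear_eq_zero_of_mem_hodgeAlternating l hB)
    (Fin.cons u w : Fin (2 * n + 1 + 1) → Fin (n + 1) → ℂ)
  rw [wedgeLinear_apply, Fin.sum_univ_succ] at h
  simp only [Fin.val_zero, pow_zero, one_mul, Fin.cons_zero, hu, Fin.cons_succ, Fin.val_succ,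
    Fin.removeNth_zero, Fin.tail_cons] at h
  have h2 : ∀ i : Fin (2 * n + 1), (-1 : ℂ) ^ ((i : ℕ) + 1) * l (w i) *
      B (Fin.removeNth i.succ (Fin.cons u w : Fin (2 * n + 1 + 1) → Fin (n + 1) → ℂ)) =
      -((-1) ^ (i : ℕ) * l (w i) * B.curryLeft u (i.removeNth w)) := fun i => by
    have h3 : Fin.removeNth i.succ (Fin.cons u w : Fin (2 * n + 1 + 1) → Fin (n + 1) → ℂ) =
        Fin.cons u (i.removeNth w) := by
      funext j
      refine Fin.cases ?_ (fun j => ?_) j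
      · simp [Fin.removeNth]
      · simp [Fin.removeNth]
    rw [h3, ContinuousAlternatingMap.curryLeft_apply_apply]
    simp only [Matrix.vecCons]
    ring
  rw [Finset.sum_congr rfl fun i _ => h2 i, Finset.sum_neg_distrib] at h
  have h3 : (0 : (Fin (n + 1) → ℂ) [⋀^Fin (2 * n + 1 + 1)]→L[ℝ] ℂ) (Fin.cons u w) = 0 := rfl
  rw [h3] at h
  linear_combination h

/-- Complex linear maps commute with complex scalars, hence preserve each type. -/
lemma compContinuousLinearMap_mem_hodgeAlternating {m m' p k : ℕ}
    {B : (Fin m' → ℂ) [⋀^Fin k]→L[ℝ] ℂ} (hB : B ∈ hodgeAlternating m' p k)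
    (L : (Fin m → ℂ) →L[ℂ] (Fin m' → ℂ)) :
    B.compContinuousLinearMap (L.restrictScalars ℝ) ∈ hodgeAlternating m p k := by
  let T : ((Fin m' → ℂ) [⋀^Fin k]→L[ℝ] ℂ) →ₗ[ℂ] ((Fin m → ℂ) [⋀^Fin k]→L[ℝ] ℂ) :=
    { toFun := fun B => B.compContinuousLinearMap (L.restrictScalars ℝ)
      map_add' := fun _ _ => rfl
      map_smul' := fun _ _ => rfl }
  have h : hodgeAlternating m' p k ≤ (hodgeAlternating m p k).comap T := by
    refine iSup₂_le fun a ha B hB => ?_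
    refine Submodule.mem_iSup_of_mem a (Submodule.mem_iSup_of_mem ha fun c v => ?_)
    have h1 := hB c fun i => L (v i)
    simp only [← map_smul] at h1
    exact h1
  exact h hB

end HodgeType

/-! ### Existence of Gelfand–Leray forms. -/

section GelfandLeray

variable {n : ℕ} {Z : Type*} [TopologicalSpace Z] [ChartedSpace (Fin (n + 1) → ℂ) Z]

/-- In an adapted chart `f` is the first coordinate, so `df` reads off the first component. -/
lemma IsAdaptedChart.differentialAt_tangentMapAt [IsManifold 𝓘(ℂ, Fin (n + 1) → ℂ) ω Z]
    {f : Z → ℂ} (hf : MDifferentiable 𝓘(ℂ, Fin (n + 1) → ℂ) 𝓘(ℂ, ℂ) f)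
    {φ : OpenPartialHomeomorph Z (Fin (n + 1) → ℂ)} (hφ : IsAdaptedChart f φ)
    {y : Fin (n + 1) → ℂ} (hy : y ∈ φ.target) (u : Fin (n + 1) → ℂ) :
    differentialAt f (φ.symm y) (tangentMapAt (m := n + 1) (m' := n + 1) φ.symm y u) = u 0 := by
  have h1 := differentialAt_comp (hf (φ.symm y))
    ((contMDiffAt_symm_of_mem_maximalAtlas hφ.mem_maximalAtlas hy).mdifferentiableAt (by simp))
  have h2 : f ∘ φ.symm =ᶠ[nhds y] fun y => y 0 := by
    filter_upwards [φ.open_target.mem_nhds hy] with x hx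
    rw [Function.comp_apply, ← hφ.apply_zero _ (φ.map_target hx), φ.right_inv hx]
  rw [differentialAt_eq_fderiv, h2.fderiv_eq] at h1
  have h3 := DFunLike.congr_fun h1 u
  rw [ContinuousLinearMap.comp_apply] at h3
  rw [← h3, (hasFDerivAt_apply (𝕜 := ℂ) (0 : Fin (n + 1)) y).fderiv]
  rfl

variable {m k : ℕ} {M : Type*} [TopologicalSpace M] [ChartedSpace (Fin m → ℂ) M]

/-- The product of a function and a form. -/
noncomputable def smulForm (ρ : M → ℝ) (ξ : FormField m M k) : FormField m M k :=
  fun x => (ρ x : ℂ) • ξ x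

omit [TopologicalSpace M] [ChartedSpace (Fin m → ℂ) M] in
lemma smulForm_eq_zero_of_eq_zero {ρ : M → ℝ} (ξ : FormField m M k) {x : M} (hx : ρ x = 0) :
    smulForm ρ ξ x = 0 := by
  simp only [smulForm, hx, Complex.ofReal_zero]
  exact zero_smul ℂ (ξ x)

lemma coordForm_smulForm (ρ : M → ℝ) (ξ : FormField m M k)
    (φ : OpenPartialHomeomorph M (Fin m → ℂ)) (y : Fin m → ℂ) :
    coordForm (smulForm ρ ξ) φ y = (ρ (φ.symm y) : ℂ) • coordForm ξ φ y := rfl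

lemma contDiffAt_comp_symm [IsManifold 𝓘(ℂ, Fin m → ℂ) ω M] {ρ : M → ℝ}
    (hρ : ContMDiff 𝓘(ℝ, Fin m → ℂ) 𝓘(ℝ, ℝ) ∞ ρ) {φ : OpenPartialHomeomorph M (Fin m → ℂ)}
    (hφ : φ ∈ IsManifold.maximalAtlas 𝓘(ℂ, Fin m → ℂ) ω M) {y : Fin m → ℂ} (hy : y ∈ φ.target) :
    ContDiffAt ℝ ∞ (fun y => (ρ (φ.symm y) : ℂ)) y := by
  have h1 : ContMDiffAt 𝓘(ℝ, Fin m → ℂ) 𝓘(ℝ, ℝ) ∞ (ρ ∘ φ.symm) y :=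
    (hρ _).comp y (contMDiffAt_symm_of_mem_maximalAtlas (mem_maximalAtlas_real hφ) hy)
  exact Complex.ofRealCLM.contDiff.contDiffAt.comp y (contMDiffAt_iff_contDiffAt.1 h1)

lemma contDiffAt_coordForm_smulForm [IsManifold 𝓘(ℂ, Fin m → ℂ) ω M] {ρ : M → ℝ}
    (hρ : ContMDiff 𝓘(ℝ, Fin m → ℂ) 𝓘(ℝ, ℝ) ∞ ρ) {ξ : FormField m M k}
    {φ : OpenPartialHomeomorph M (Fin m → ℂ)}
    (hφ : φ ∈ IsManifold.maximalAtlas 𝓘(ℂ, Fin m → ℂ) ω M) {y : Fin m → ℂ} (hy : y ∈ φ.target)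
    (hξ : ContDiffAt ℝ ∞ (coordForm ξ φ) y) :
    ContDiffAt ℝ ∞ (coordForm (smulForm ρ ξ) φ) y :=
  (contDiffAt_comp_symm hρ hφ hy).smul hξ

lemma smulForm_mem_smoothForms [IsManifold 𝓘(ℂ, Fin m → ℂ) ω M] {ρ : M → ℝ}
    (hρ : ContMDiff 𝓘(ℝ, Fin m → ℂ) 𝓘(ℝ, ℝ) ∞ ρ) {ξ : FormField m M k}
    (hξ : ξ ∈ smoothForms m M k) : smulForm ρ ξ ∈ smoothForms m M k :=
  mem_smoothForms_of_forall_exists_chart fun x =>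
    ⟨chartAt _ x, IsManifold.chart_mem_maximalAtlas x, mem_chart_source _ x,
      contDiffAt_coordForm_smulForm hρ (IsManifold.chart_mem_maximalAtlas x) (mem_chart_target _ x)
        (contDiffAt_coordForm hξ (IsManifold.chart_mem_maximalAtlas x) (mem_chart_target _ x))⟩

/-- The contraction of a form with the first coordinate vector field of a chart. -/
noncomputable def contractChart (φ : OpenPartialHomeomorph Z (Fin (n + 1) → ℂ))
    (η : FormField (n + 1) Z (k + 1)) : FormField (n + 1) Z k :=
  fun x => (η x).curryLeft (tangentMapAt (m := n + 1) (m' := n + 1) φ.symm (φ x) (Pi.single 0 1))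

lemma coordForm_contractChart (φ : OpenPartialHomeomorph Z (Fin (n + 1) → ℂ))
    (η : FormField (n + 1) Z (k + 1)) {y : Fin (n + 1) → ℂ} (hy : y ∈ φ.target) :
    coordForm (contractChart φ η) φ y = (coordForm η φ y).curryLeft (Pi.single 0 1) := by
  ext v
  simp only [coordForm, contractChart, ContinuousAlternatingMap.compContinuousLinearMap_apply,
    ContinuousAlternatingMap.curryLeft_apply_apply, φ.right_inv hy]
  congr 1
  funext i
  refine Fin.cases ?_ (fun j => ?_) i <;> rfl

variable [T2Space Z] [IsManifold 𝓘(ℂ, Fin (n + 1) → ℂ) ω Z] [SigmaCompactSpace Z]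

/-- A form in `F^{n+1} A^{2n+1}` on the total space of a submersion has a Gelfand–Leray form. -/
lemma exists_isGelfandLeray {f : Z → ℂ}
    (hf : MDifferentiable 𝓘(ℂ, Fin (n + 1) → ℂ) 𝓘(ℂ, ℂ) f)
    (hfs : ∀ z, Function.Surjective (differentialAt (m := n + 1) f z))
    {η : FormField (n + 1) Z (2 * n + 1)} (hη : η ∈ smoothForms (n + 1) Z (2 * n + 1))
    (hηF : η ∈ hodgeForms (n + 1) Z (n + 1) (2 * n + 1)) :
    ∃ θ, IsGelfandLeray f η θ := by
  obtain ⟨ρ, φ, h⟩ := exists_smoothPartitionOfUnity_isAdaptedChart hf hfs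
  -- The contraction of `η` with the first coordinate field of an adapted chart solves `η = df ∧ θ`
  -- there. The equation is affine in `θ`, so weighted averages of local solutions are again
  -- solutions.
  let ξ : Z → FormField (n + 1) Z (2 * n) := fun i => smulForm (ρ i) (contractChart (φ i) η)
  have hξ0 : ∀ i x, x ∉ Function.support (ρ i) → ξ i x = 0 := fun i x hx =>
    smulForm_eq_zero_of_eq_zero _ (Function.notMem_support.1 hx)
  have hsum : ∀ x, ∀ I : Finset Z, ρ.finsupport x ⊆ I → ∑ᶠ i, ξ i x = ∑ i ∈ I, ξ i x := by
    intro x I hI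
    refine finsum_eq_sum_of_support_subset _ fun i hi => hI ?_
    rw [SmoothPartitionOfUnity.mem_finsupport]
    by_contra hx
    exact hi (hξ0 i x hx)
  refine ⟨fun x => ∑ᶠ i, ξ i x, mem_smoothForms_of_forall_exists_chart fun x => ?_, fun x v => ?_⟩
  · refine ⟨chartAt _ x, IsManifold.chart_mem_maximalAtlas x, mem_chart_source _ x, ?_⟩
    have hχ := IsManifold.chart_mem_maximalAtlas (I := 𝓘(ℂ, Fin (n + 1) → ℂ)) (n := ω) x
    set χ := chartAt (Fin (n + 1) → ℂ) x
    have hx : x ∈ χ.source := mem_chart_source _ x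
    have hev : coordForm (fun x => ∑ᶠ i, ξ i x : FormField (n + 1) Z (2 * n)) χ =ᶠ[nhds (χ x)]
        fun y => ∑ i ∈ ρ.fintsupport x, coordForm (ξ i) χ y := by
      have h1 : Filter.Tendsto χ.symm (nhds (χ x)) (nhds x) := by
        have := χ.continuousAt_symm (χ.map_source hx)
        rwa [ContinuousAt, χ.left_inv hx] at this
      filter_upwards [h1.eventually (ρ.eventually_finsupport_subset x)] with y hy
      ext v
      simp only [coordForm, hsum _ _ hy, ContinuousAlternatingMap.compContinuousLinearMap_apply,
        ContinuousAlternatingMap.sum_apply]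
    refine ContDiffAt.congr_of_eventuallyEq (ContDiffAt.sum fun i hi => ?_) hev
    have hxi : x ∈ (φ i).source := (h i).2.1 ((ρ.mem_fintsupport_iff x i).1 hi)
    have hφi := (h i).1.mem_maximalAtlas
    have hyi := (φ i).map_source hxi
    refine contDiffAt_coordForm_of_chart hχ hφi hx hxi
      (contDiffAt_coordForm_smulForm (ρ i).contMDiff hφi hyi ?_)
    have hev : coordForm (contractChart (φ i) η) (φ i) =ᶠ[nhds (φ i x)]
        fun y => (coordForm η (φ i) y).curryLeft (Pi.single 0 1) := by
      filter_upwards [(φ i).open_target.mem_nhds hyi] with y hy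
      exact coordForm_contractChart _ _ hy
    refine ContDiffAt.congr_of_eventuallyEq ?_ hev
    rw [contDiffAt_continuousAlternatingMap_iff]
    intro v
    exact contDiffAt_continuousAlternatingMap_iff.1 (contDiffAt_coordForm hη hφi hyi) _
  · have h1 := ρ.sum_finsupport x (Set.mem_univ x)
    have hl : ∀ j ∈ ρ.finsupport x, η x v = ∑ i : Fin (2 * n + 1), (-1) ^ (i : ℕ) *
        differentialAt f x (v i) * contractChart (φ j) η x (i.removeNth v) := fun j hj => by
      have hxj : x ∈ (φ j).source := (h j).2.1 (subset_tsupport _ ((ρ.mem_finsupport x).1 hj))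
      refine apply_eq_sum_of_mem_hodgeAlternating _ (hηF x) ?_ v
      have h2 := (h j).1.differentialAt_tangentMapAt hf ((φ j).map_source hxj) (Pi.single 0 1)
      rw [(φ j).left_inv hxj] at h2
      simpa using h2
    calc η x v = ∑ j ∈ ρ.finsupport x, (ρ j x : ℂ) * η x v := by
          rw [← Finset.sum_mul, ← Complex.ofReal_sum, h1, Complex.ofReal_one, one_mul]
      _ = ∑ j ∈ ρ.finsupport x, (ρ j x : ℂ) * ∑ i : Fin (2 * n + 1), (-1) ^ (i : ℕ) *
        differentialAt f x (v i) * contractChart (φ j) η x (i.removeNth v) :=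
          Finset.sum_congr rfl fun j hj => by rw [← hl j hj]
      _ = ∑ i : Fin (2 * n + 1), (-1) ^ (i : ℕ) * differentialAt f x (v i) *
          (∑ᶠ i, ξ i x) (i.removeNth v) := by
        rw [hsum x _ subset_rfl]
        simp only [ContinuousAlternatingMap.sum_apply, Finset.mul_sum]
        rw [Finset.sum_comm]
        refine Finset.sum_congr rfl fun i _ => Finset.sum_congr rfl fun j _ => ?_
        simp only [ξ, smulForm, ContinuousAlternatingMap.smul_apply, smul_eq_mul]
        ring

end GelfandLeray

/-! ### Extension by zero. -/

section ZeroExtension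

variable {E F : Type*} [TopologicalSpace E] [Zero F] {T C : Set E} {u : E → F}

/-- The closed set `C` carries `u` within `T`, so the extension by zero has no jump at boundary
points of `T` outside `C`. -/
lemma indicator_eventuallyEq_zero_of_notMem (hC : IsClosed C) (hu : ∀ y ∈ T, y ∉ C → u y = 0)
    {y : E} (hy : y ∉ C) : T.indicator u =ᶠ[nhds y] fun _ => 0 := by
  filter_upwards [hC.isOpen_compl.mem_nhds hy] with x hx
  by_cases hxT : x ∈ T
  · rw [Set.indicator_of_mem hxT, hu x hxT hx]
  · rw [Set.indicator_of_notMem hxT]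

lemma indicator_eventuallyEq_of_isOpen (hT : IsOpen T) {y : E} (hy : y ∈ T) :
    T.indicator u =ᶠ[nhds y] u := by
  filter_upwards [hT.mem_nhds hy] with x hx
  exact Set.indicator_of_mem hx u

lemma continuous_indicator_of_isClosed (hT : IsOpen T) (hC : IsClosed C) (hCT : C ⊆ T)
    (hu : ∀ y ∈ T, y ∉ C → u y = 0) [TopologicalSpace F] (hc : ContinuousOn u T) :
    Continuous (T.indicator u) := by
  refine continuous_iff_continuousAt.2 fun y => ?_
  by_cases hy : y ∈ C
  · exact (hc.continuousAt (hT.mem_nhds (hCT hy))).congr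
      (indicator_eventuallyEq_of_isOpen hT (hCT hy)).symm
  · exact continuousAt_const.congr (indicator_eventuallyEq_zero_of_notMem hC hu hy).symm

lemma hasCompactSupport_indicator [R1Space E] (hC : IsCompact C) (hu : ∀ y ∈ T, y ∉ C → u y = 0) :
    HasCompactSupport (T.indicator u) := by
  refine HasCompactSupport.intro hC fun y hy => ?_
  by_cases hyT : y ∈ T
  · rw [Set.indicator_of_mem hyT, hu y hyT hy]
  · rw [Set.indicator_of_notMem hyT]

lemma contDiff_indicator_of_isClosed {E F : Type*} [NormedAddCommGroup E] [NormedSpace ℝ E]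
    [NormedAddCommGroup F] [NormedSpace ℝ F] {T C : Set E} {u : E → F} {m : WithTop ℕ∞} (hT : IsOpen T) (hC : IsClosed C)
    (hCT : C ⊆ T) (hu : ∀ y ∈ T, y ∉ C → u y = 0) (hc : ∀ y ∈ T, ContDiffAt ℝ m u y) :
    ContDiff ℝ m (T.indicator u) := by
  refine contDiff_iff_contDiffAt.2 fun y => ?_
  by_cases hy : y ∈ C
  · exact (hc y (hCT hy)).congr_of_eventuallyEq (indicator_eventuallyEq_of_isOpen hT (hCT hy))
  · exact contDiffAt_const.congr_of_eventuallyEq (indicator_eventuallyEq_zero_of_notMem hC hu hy)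

end ZeroExtension

/-! ### Horizontal slices and vertical directions in coordinates. -/

section Slices

variable {n : ℕ}

/-- The inclusion of the vertical directions. -/
noncomputable def verticalIncl (n : ℕ) : (Fin n → ℂ) →L[ℂ] (Fin (n + 1) → ℂ) :=
  LinearMap.toContinuousLinearMap
    { toFun := fun w => Fin.cons 0 w
      map_add' := fun v w => by
        funext i; refine Fin.cases ?_ (fun j => ?_) i <;> simp
      map_smul' := fun c w => by
        funext i; refine Fin.cases ?_ (fun j => ?_) i <;> simp }

@[simp]
lemma verticalIncl_apply (w : Fin n → ℂ) : verticalIncl n w = Fin.cons 0 w := rfl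

/-- The projection onto the fibre coordinates. -/
noncomputable def tailProj (n : ℕ) : (Fin (n + 1) → ℂ) →L[ℂ] (Fin n → ℂ) :=
  ContinuousLinearMap.pi fun i => ContinuousLinearMap.proj i.succ

@[simp]
lemma tailProj_apply (y : Fin (n + 1) → ℂ) : tailProj n y = Fin.tail y := rfl

lemma cons_eq_add_verticalIncl (s : ℂ) (w : Fin n → ℂ) :
    (Fin.cons s w : Fin (n + 1) → ℂ) = Pi.single 0 s + verticalIncl n w := by
  funext i
  refine Fin.cases ?_ (fun j => ?_) i <;> simp

lemma hasFDerivAt_cons (s : ℂ) (w : Fin n → ℂ) :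
    HasFDerivAt (fun w => (Fin.cons s w : Fin (n + 1) → ℂ)) (verticalIncl n) w := by
  simp only [cons_eq_add_verticalIncl]
  exact (verticalIncl n).hasFDerivAt.const_add _

lemma continuous_cons : Continuous fun p : ℂ × (Fin n → ℂ) => (Fin.cons p.1 p.2 : Fin (n + 1) → ℂ) := by
  refine continuous_pi fun i => ?_
  refine Fin.cases ?_ (fun j => ?_) i
  · simpa using continuous_fst
  · simp only [Fin.cons_succ]
    exact (continuous_apply j).comp continuous_snd

lemma continuous_cons_left (s : ℂ) : Continuous fun w => (Fin.cons s w : Fin (n + 1) → ℂ) :=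
  continuous_cons.comp (Continuous.prodMk_right s)

lemma isClosedEmbedding_cons (s : ℂ) :
    Topology.IsClosedEmbedding fun w => (Fin.cons s w : Fin (n + 1) → ℂ) :=
  Function.LeftInverse.isClosedEmbedding (f := Fin.tail) (fun w => Fin.tail_cons s w)
    (tailProj n).continuous (continuous_cons_left s)

/-- The vectors of the real frame of `ℂ ^ n`, as vertical vectors. -/
noncomputable def verticalFrame (n : ℕ) : Fin (2 * n) → Fin (n + 1) → ℂ :=
  fun k => Fin.cons 0 (realFrame n k)

end Slices

/-! ### Integrals over the fibres in adapted charts. -/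

section FibreIntegrals

variable {n : ℕ} {Z : Type*} [TopologicalSpace Z] [ChartedSpace (Fin (n + 1) → ℂ) Z]

/-- The density of a `2n`-form on the fibres, in an adapted chart. -/
noncomputable def fibreDensity (ξ : FormField (n + 1) Z (2 * n))
    (φ : OpenPartialHomeomorph Z (Fin (n + 1) → ℂ)) (ρ : Z → ℝ) : (Fin (n + 1) → ℂ) → ℂ :=
  φ.target.indicator fun y => (ρ (φ.symm y) : ℂ) * coordForm ξ φ y (verticalFrame n)

lemma chartFibreIntegral_eq_integral (ξ : FormField (n + 1) Z (2 * n))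
    (φ : OpenPartialHomeomorph Z (Fin (n + 1) → ℂ)) (ρ : Z → ℝ) (s : ℂ) :
    chartFibreIntegral ξ φ ρ s = ∫ w : Fin n → ℂ, fibreDensity ξ φ ρ (Fin.cons s w) := by
  classical
  rw [chartFibreIntegral]
  congr 1

/-- A `2n`-form whose restriction to the fibres is continuous. -/
def FibreContinuous (f : Z → ℂ) (ξ : FormField (n + 1) Z (2 * n)) : Prop :=
  ∀ φ : OpenPartialHomeomorph Z (Fin (n + 1) → ℂ), IsAdaptedChart f φ →
    ContinuousOn (fun y => coordForm ξ φ y (verticalFrame n)) φ.target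

lemma FibreContinuous.smulForm {f : Z → ℂ} {ξ : FormField (n + 1) Z (2 * n)}
    (hξ : FibreContinuous f ξ) {ρ : Z → ℝ} (hρ : Continuous ρ) :
    FibreContinuous f (smulForm ρ ξ) := fun φ hφ =>
  (Complex.continuous_ofReal.comp_continuousOn
    (hρ.comp_continuousOn φ.continuousOn_symm)).mul (hξ φ hφ)

variable {f : Z → ℂ}

section Density

variable {ξ : FormField (n + 1) Z (2 * n)} (hξ : FibreContinuous f ξ)
  {φ : OpenPartialHomeomorph Z (Fin (n + 1) → ℂ)} (hφ : IsAdaptedChart f φ) {ρ : Z → ℝ}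
  (hρ : Continuous ρ) {K : Set Z} (hK : IsCompact K) (hKφ : K ⊆ φ.source)
  (hK0 : ∀ z, z ∉ K → ρ z = 0 ∨ ξ z = 0)

include hK0 in
-- Vanishing off `K` may come from the weight or from the form: comparing two partitions requires
-- both.
lemma fibreDensity_aux : ∀ y ∈ φ.target, y ∉ φ '' K →
    (ρ (φ.symm y) : ℂ) * coordForm ξ φ y (verticalFrame n) = 0 := by
  intro y hy hyK
  have h1 : φ.symm y ∉ K := fun h => hyK ⟨_, h, φ.right_inv hy⟩
  rcases hK0 _ h1 with h | h
  · simp [h]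
  · simp [coordForm, h]

omit [ChartedSpace (Fin (n + 1) → ℂ) Z] in
include hK hKφ in
lemma isCompact_image_chart : IsCompact (φ '' K) :=
  hK.image_of_continuousOn (φ.continuousOn.mono hKφ)

omit [ChartedSpace (Fin (n + 1) → ℂ) Z] in
include hKφ in
lemma image_chart_subset_target : φ '' K ⊆ φ.target := by
  rintro _ ⟨z, hz, rfl⟩
  exact φ.map_source (hKφ hz)

include hξ hφ hρ hK hKφ hK0

lemma continuous_fibreDensity : Continuous (fibreDensity ξ φ ρ) :=
  continuous_indicator_of_isClosed φ.open_target (isCompact_image_chart hK hKφ).isClosed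
    (image_chart_subset_target hKφ) (fibreDensity_aux hK0)
    ((Complex.continuous_ofReal.comp_continuousOn
      (hρ.comp_continuousOn φ.continuousOn_symm)).mul (hξ φ hφ))

omit hξ hφ hρ in
lemma hasCompactSupport_fibreDensity : HasCompactSupport (fibreDensity ξ φ ρ) :=
  hasCompactSupport_indicator (isCompact_image_chart hK hKφ) (fibreDensity_aux hK0)

lemma integrable_fibreDensity (s : ℂ) :
    MeasureTheory.Integrable fun w : Fin n → ℂ => fibreDensity ξ φ ρ (Fin.cons s w) :=
  ((continuous_fibreDensity hξ hφ hρ hK hKφ hK0).comp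
    (continuous_cons_left s)).integrable_of_hasCompactSupport
    ((hasCompactSupport_fibreDensity hK hKφ hK0).comp_isClosedEmbedding (isClosedEmbedding_cons s))

end Density

/-- Two `2n`-forms with the same restriction to a fibre, multiplied by weights, have the same
integral. -/
lemma chartFibreIntegral_congr {φ : OpenPartialHomeomorph Z (Fin (n + 1) → ℂ)}
    (hφ : IsAdaptedChart f φ) {ξ ξ' : FormField (n + 1) Z (2 * n)} {ρ ρ' : Z → ℝ} {s : ℂ}
    (h : ∀ z, f z = s → (ρ z : ℂ) • ξ z = (ρ' z : ℂ) • ξ' z) :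
    chartFibreIntegral ξ φ ρ s = chartFibreIntegral ξ' φ ρ' s := by
  rw [chartFibreIntegral_eq_integral, chartFibreIntegral_eq_integral]
  congr 1
  funext w
  by_cases hw : (Fin.cons s w : Fin (n + 1) → ℂ) ∈ φ.target
  · have h1 : f (φ.symm (Fin.cons s w)) = s := by
      rw [← hφ.apply_zero _ (φ.map_target hw), φ.right_inv hw, Fin.cons_zero]
    rw [fibreDensity, fibreDensity, Set.indicator_of_mem hw, Set.indicator_of_mem hw]
    have h2 := DFunLike.congr_fun (h _ h1) fun k =>
      tangentMapAt (m := n + 1) (m' := n + 1) φ.symm (Fin.cons s w) (verticalFrame n k)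
    exact h2
  · rw [fibreDensity, fibreDensity, Set.indicator_of_notMem hw, Set.indicator_of_notMem hw]

variable {φ ψ : OpenPartialHomeomorph Z (Fin (n + 1) → ℂ)} (hφ : IsAdaptedChart f φ)
  (hψ : IsAdaptedChart f ψ)

include hφ hψ

/-- Both charts have `f` as first coordinate, so passing from one to the other maps each slice to
the slice at the same height. -/
lemma coordMap_cons_eq {s : ℂ} {w : Fin n → ℂ} (hw : (Fin.cons s w : Fin (n + 1) → ℂ) ∈ φ.target)
    (hw' : φ.symm (Fin.cons s w) ∈ ψ.source) :
    coordMap id φ ψ (Fin.cons s w) =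
      Fin.cons s (Fin.tail (coordMap id φ ψ (Fin.cons s w))) := by
  have h1 : coordMap id φ ψ (Fin.cons s w) 0 = s := by
    rw [coordMap, id, hψ.apply_zero _ hw', ← hφ.apply_zero _ (φ.map_target hw), φ.right_inv hw,
      Fin.cons_zero]
  conv_lhs => rw [← Fin.cons_self_tail (coordMap id φ ψ (Fin.cons s w)), h1]

/-- The derivative of a change of adapted charts preserves vertical vectors. -/
lemma fderiv_coordMap_verticalIncl {y : Fin (n + 1) → ℂ} (hy : y ∈ φ.target)
    (hy' : φ.symm y ∈ ψ.source) (u : Fin n → ℂ) :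
    fderiv ℂ (coordMap id φ ψ) y (verticalIncl n u) =
      verticalIncl n (tailProj n (fderiv ℂ (coordMap id φ ψ) y (verticalIncl n u))) := by
  have hd := differentiableAt_coordMap (g := (id : Z → Z)) mdifferentiable_id hφ.mem_maximalAtlas
    hψ.mem_maximalAtlas hy hy'
  have h1 : (fun y => coordMap id φ ψ y 0) =ᶠ[nhds y] fun y => y 0 := by
    filter_upwards [(isOpen_coordMap_domain (g := (id : Z → Z)) mdifferentiable_id).mem_nhds
      (⟨hy, hy'⟩ : y ∈ {y | y ∈ φ.target ∧ id (φ.symm y) ∈ ψ.source})] with x hx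
    change ψ (φ.symm x) 0 = x 0
    rw [hψ.apply_zero (φ.symm x) hx.2, ← hφ.apply_zero _ (φ.map_target hx.1), φ.right_inv hx.1]
  have h2 : fderiv ℂ (coordMap id φ ψ) y (verticalIncl n u) 0 = 0 := by
    have h3 := (hasFDerivAt_apply (𝕜 := ℂ) (0 : Fin (n + 1))
      (coordMap id φ ψ y)).comp y hd.hasFDerivAt
    have h4 := h3.unique ((hasFDerivAt_apply (𝕜 := ℂ) (0 : Fin (n + 1)) y).congr_of_eventuallyEq h1)
    have h5 := DFunLike.congr_fun h4 (verticalIncl n u)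
    simpa using h5
  rw [verticalIncl_apply (tailProj n _), tailProj_apply, ← h2, Fin.cons_self_tail]

/-- The fibre integral of a form supported in the domains of two adapted charts is the same in
both charts. -/
lemma chartFibreIntegral_eq_of_chart {ξ : FormField (n + 1) Z (2 * n)} {ρ : Z → ℝ}
    (h0 : ∀ z, z ∉ φ.source ∨ z ∉ ψ.source → ρ z = 0 ∨ ξ z = 0) (s : ℂ) :
    chartFibreIntegral ξ φ ρ s = chartFibreIntegral ξ ψ ρ s := by
  let S (φ ψ : OpenPartialHomeomorph Z (Fin (n + 1) → ℂ)) : Set (Fin n → ℂ) :=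
    {w | (Fin.cons s w : Fin (n + 1) → ℂ) ∈ φ.target ∧ φ.symm (Fin.cons s w) ∈ ψ.source}
  let τ (φ ψ : OpenPartialHomeomorph Z (Fin (n + 1) → ℂ)) : (Fin n → ℂ) → (Fin n → ℂ) :=
    fun w => Fin.tail (coordMap id φ ψ (Fin.cons s w))
  -- reduction to the overlap
  have hred : ∀ φ ψ : OpenPartialHomeomorph Z (Fin (n + 1) → ℂ), IsAdaptedChart f φ →
      IsAdaptedChart f ψ → (∀ z, z ∉ φ.source ∨ z ∉ ψ.source → ρ z = 0 ∨ ξ z = 0) →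
      chartFibreIntegral ξ φ ρ s =
        ∫ w in S φ ψ, (ρ (φ.symm (Fin.cons s w)) : ℂ) *
          coordForm ξ φ (Fin.cons s w) (verticalFrame n) := by
    intro φ ψ hφ hψ h0
    have hSo : IsOpen (S φ ψ) := (isOpen_coordMap_domain (g := (id : Z → Z)) (φ := φ) (χ := ψ)
      mdifferentiable_id).preimage (continuous_cons_left s)
    rw [chartFibreIntegral_eq_integral, ← MeasureTheory.integral_indicator hSo.measurableSet]
    congr 1
    funext w
    by_cases hw : (Fin.cons s w : Fin (n + 1) → ℂ) ∈ φ.target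
    · rw [fibreDensity, Set.indicator_of_mem hw]
      by_cases hw' : φ.symm (Fin.cons s w) ∈ ψ.source
      · rw [Set.indicator_of_mem (show w ∈ S φ ψ from ⟨hw, hw'⟩)]
      · rw [Set.indicator_of_notMem (show w ∉ S φ ψ from fun h => hw' h.2)]
        rcases h0 _ (Or.inr hw') with h | h
        · simp [h]
        · simp [coordForm, h]
    · rw [fibreDensity, Set.indicator_of_notMem hw,
        Set.indicator_of_notMem (show w ∉ S φ ψ from fun h => hw h.1)]
  have hτ : ∀ φ ψ : OpenPartialHomeomorph Z (Fin (n + 1) → ℂ), IsAdaptedChart f φ →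
      IsAdaptedChart f ψ → ∀ w ∈ S φ ψ, τ φ ψ w ∈ S ψ φ ∧ τ ψ φ (τ φ ψ w) = w := by
    intro φ ψ hφ hψ w hw
    have h1 := coordMap_cons_eq hφ hψ hw.1 hw.2
    have h2 : ψ.symm (Fin.cons s (τ φ ψ w)) = φ.symm (Fin.cons s w) := by
      rw [← h1]; exact ψ.left_inv hw.2
    refine ⟨⟨?_, ?_⟩, ?_⟩
    · rw [← h1]; exact ψ.map_source hw.2
    · rw [h2]; exact φ.map_target hw.1
    · change Fin.tail (φ (ψ.symm (Fin.cons s (τ φ ψ w)))) = w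
      rw [h2, φ.right_inv hw.1, Fin.tail_cons]
  have himage : τ φ ψ '' S φ ψ = S ψ φ := by
    ext w
    constructor
    · rintro ⟨w, hw, rfl⟩
      exact (hτ φ ψ hφ hψ w hw).1
    · intro hw
      exact ⟨_, (hτ ψ φ hψ hφ w hw).1, (hτ ψ φ hψ hφ w hw).2⟩
  let τ' : (Fin n → ℂ) → (Fin n → ℂ) →L[ℂ] (Fin n → ℂ) := fun w =>
    (tailProj n).comp ((fderiv ℂ (coordMap id φ ψ) (Fin.cons s w)).comp (verticalIncl n))
  have hderiv : ∀ w ∈ S φ ψ, HasFDerivAt (τ φ ψ) (τ' w) w := fun w hw =>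
    (tailProj n).hasFDerivAt.comp w (((differentiableAt_coordMap (g := (id : Z → Z))
      mdifferentiable_id hφ.mem_maximalAtlas hψ.mem_maximalAtlas hw.1 hw.2).hasFDerivAt).comp w
        (hasFDerivAt_cons s w))
  have hSo : IsOpen (S φ ψ) := (isOpen_coordMap_domain (g := (id : Z → Z)) (φ := φ) (χ := ψ)
      mdifferentiable_id).preimage (continuous_cons_left s)
  rw [hred φ ψ hφ hψ h0, hred ψ φ hψ hφ fun z hz => h0 z hz.symm, ← himage,
    MeasureTheory.integral_image_eq_integral_abs_det_fderiv_smul MeasureTheory.volume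
      hSo.measurableSet (fun w hw => ((hderiv w hw).restrictScalars ℝ).hasFDerivWithinAt)
      (fun w hw w' hw' h => by
        rw [← (hτ φ ψ hφ hψ w hw).2, ← (hτ φ ψ hφ hψ w' hw').2, h])]
  refine MeasureTheory.setIntegral_congr_fun hSo.measurableSet fun w hw => ?_
  -- The Jacobian is the squared modulus of the complex determinant of the vertical block, exactly
  -- the factor by which the form transforms on the vertical frame (`hform`).
  have hdet : |((τ' w).restrictScalars ℝ).det| =
      Complex.normSq (LinearMap.det (τ' w).toLinearMap) := by
    have h1 := det_restrictScalars_eq_normSq (τ' w).toLinearMap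
    have h2 : ((τ' w).restrictScalars ℝ).det =
      LinearMap.det ((τ' w).toLinearMap.restrictScalars ℝ) := rfl
    rw [h2, h1, abs_of_nonneg (Complex.normSq_nonneg _)]
  have hcons := coordMap_cons_eq hφ hψ hw.1 hw.2
  have hsymm : ψ.symm (Fin.cons s (τ φ ψ w)) = φ.symm (Fin.cons s w) := by
    rw [← hcons]; exact ψ.left_inv hw.2
  have hform : coordForm ξ φ (Fin.cons s w) (verticalFrame n) =
      (Complex.normSq (LinearMap.det (τ' w).toLinearMap) : ℝ) *
        coordForm ξ ψ (Fin.cons s (τ φ ψ w)) (verticalFrame n) := by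
    have h1 := coordForm_pullbackForm (g := (id : Z → Z)) mdifferentiable_id hφ.mem_maximalAtlas
      hψ.mem_maximalAtlas ξ hw.1 hw.2
    rw [pullbackForm_id, hcons, (differentiableAt_coordMap (g := (id : Z → Z)) mdifferentiable_id
      hφ.mem_maximalAtlas hψ.mem_maximalAtlas hw.1 hw.2).fderiv_restrictScalars ℝ] at h1
    rw [h1, ContinuousAlternatingMap.compContinuousLinearMap_apply]
    have h2 := ContinuousAlternatingMap.map_complexLinear_eq_normSq_det_mul rfl
      ((coordForm ξ ψ (Fin.cons s (τ φ ψ w))).compContinuousLinearMap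
        ((verticalIncl n).restrictScalars ℝ)) (τ' w).toLinearMap (realFrame n)
    refine Eq.trans ?_ h2
    rw [ContinuousAlternatingMap.compContinuousLinearMap_apply]
    refine congrArg _ (funext fun k => ?_)
    exact fderiv_coordMap_verticalIncl hφ hψ hw.1 hw.2 (realFrame n k)
  simp only [hdet, hform, hsymm, Complex.real_smul]
  ring

end FibreIntegrals

/-! ### Independence of the partition of unity. -/

section Independence

variable {n : ℕ} {Z : Type*} [TopologicalSpace Z] [ChartedSpace (Fin (n + 1) → ℂ) Z] {f : Z → ℂ}

lemma AdaptedPartition.isAdaptedChart {K : Set Z} (P : AdaptedPartition (n := n) f K)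
    (j : Fin P.card) : IsAdaptedChart f (P.chart j) :=
  ⟨P.chart_mem j, P.chart_zero j⟩

lemma AdaptedPartition.weight_eq_zero {K : Set Z} (P : AdaptedPartition (n := n) f K)
    (j : Fin P.card) {z : Z} (hz : z ∉ tsupport (P.weight j)) : P.weight j z = 0 :=
  image_eq_zero_of_notMem_tsupport hz

/-- The integral over a fibre of a form decomposed into pieces supported in adapted charts. -/
lemma sum_chartFibreIntegral_eq {ι : Type*} [Fintype ι] {ξ : ι → FormField (n + 1) Z (2 * n)}
    {ξ' : FormField (n + 1) Z (2 * n)} (hξ : ∀ j, FibreContinuous f (ξ j))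
    {φ : ι → OpenPartialHomeomorph Z (Fin (n + 1) → ℂ)} (hφ : ∀ j, IsAdaptedChart f (φ j))
    {C : ι → Set Z} (hC : ∀ j, IsCompact (C j)) (hCφ : ∀ j, C j ⊆ (φ j).source)
    (hξ0 : ∀ j z, z ∉ C j → ξ j z = 0) {K : Set Z} (Q : AdaptedPartition (n := n) f K) {s : ℂ}
    (hK : f ⁻¹' {s} ⊆ K) (hsum : ∀ z, f z = s → ∑ j, ξ j z = ξ' z) :
    ∑ j, chartFibreIntegral (ξ j) (φ j) (fun _ => 1) s =
      ∑ i, chartFibreIntegral ξ' (Q.chart i) (Q.weight i) s := by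
  -- The weights of `Q` sum to 1 on the fibre and cut each `ξ j` into pieces. The piece `(j, i)`
  -- lives in both charts and is moved to chart `i` (`h2`), where summing over `j` restores `ξ'`
  -- (`h3`).
  have h1 : ∀ j, chartFibreIntegral (ξ j) (φ j) (fun _ => 1) s =
      ∑ i, chartFibreIntegral (ξ j) (φ j) (Q.weight i) s := by
    intro j
    simp only [chartFibreIntegral_eq_integral]
    rw [← MeasureTheory.integral_finsetSum]
    · congr 1
      funext w
      by_cases hw : (Fin.cons s w : Fin (n + 1) → ℂ) ∈ (φ j).target
      · have h2 : f ((φ j).symm (Fin.cons s w)) = s := by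
          rw [← (hφ j).apply_zero _ ((φ j).map_target hw), (φ j).right_inv hw, Fin.cons_zero]
        simp only [fibreDensity, Set.indicator_of_mem hw]
        rw [← Finset.sum_mul, ← Complex.ofReal_sum, Q.sum_weight _ (hK h2)]
      · simp only [fibreDensity, Set.indicator_of_notMem hw, Finset.sum_const_zero]
    · exact fun i _ => integrable_fibreDensity (hξ j) (hφ j) (Q.continuous_weight i) (hC j) (hCφ j)
        (fun z hz => Or.inr (hξ0 j z hz)) s
  have h2 : ∀ j i, chartFibreIntegral (ξ j) (φ j) (Q.weight i) s =
      chartFibreIntegral (ξ j) (Q.chart i) (Q.weight i) s := by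
    intro j i
    refine chartFibreIntegral_eq_of_chart (hφ j) (Q.isAdaptedChart i) (fun z hz => ?_) s
    rcases hz with hz | hz
    · exact Or.inr (hξ0 j z fun h => hz (hCφ j h))
    · exact Or.inl (Q.weight_eq_zero i fun h => hz (Q.tsupport_subset i h))
  have h3 : ∀ i, ∑ j, chartFibreIntegral (ξ j) (Q.chart i) (Q.weight i) s =
      chartFibreIntegral ξ' (Q.chart i) (Q.weight i) s := by
    intro i
    simp only [chartFibreIntegral_eq_integral]
    rw [← MeasureTheory.integral_finsetSum]
    · congr 1
      funext w
      by_cases hw : (Fin.cons s w : Fin (n + 1) → ℂ) ∈ (Q.chart i).target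
      · have h2 : f ((Q.chart i).symm (Fin.cons s w)) = s := by
          rw [← (Q.isAdaptedChart i).apply_zero _ ((Q.chart i).map_target hw),
            (Q.chart i).right_inv hw, Fin.cons_zero]
        simp only [fibreDensity, Set.indicator_of_mem hw]
        rw [← Finset.mul_sum]
        congr 1
        rw [coordForm, ← hsum _ h2, ContinuousAlternatingMap.compContinuousLinearMap_apply,
          ContinuousAlternatingMap.sum_apply]
        rfl
      · simp only [fibreDensity, Set.indicator_of_notMem hw, Finset.sum_const_zero]
    · exact fun j _ => integrable_fibreDensity (hξ j) (Q.isAdaptedChart i) (Q.continuous_weight i)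
        (Q.hasCompactSupport_weight i) (Q.tsupport_subset i)
        (fun z hz => Or.inl (Q.weight_eq_zero i hz)) s
  simp only [h1, h2]
  rw [Finset.sum_comm]
  simp only [h3]

/-- The integral over a fibre does not depend on the partition of unity. -/
lemma AdaptedPartition.sum_chartFibreIntegral_eq_sum {θ : FormField (n + 1) Z (2 * n)}
    (hθ : FibreContinuous f θ) {K K' : Set Z} (P : AdaptedPartition (n := n) f K)
    (Q : AdaptedPartition (n := n) f K') {s : ℂ} (hK : f ⁻¹' {s} ⊆ K) (hK' : f ⁻¹' {s} ⊆ K') :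
    ∑ j, chartFibreIntegral θ (P.chart j) (P.weight j) s =
      ∑ i, chartFibreIntegral θ (Q.chart i) (Q.weight i) s := by
  rw [← sum_chartFibreIntegral_eq (ξ := fun j => smulForm (P.weight j) θ)
    (fun j => hθ.smulForm (P.continuous_weight j)) P.isAdaptedChart P.hasCompactSupport_weight
    P.tsupport_subset (fun j z hz => ?_) Q hK' fun z hz => ?_]
  · refine Finset.sum_congr rfl fun j _ => chartFibreIntegral_congr (P.isAdaptedChart j)
      fun z _ => ?_
    rw [Complex.ofReal_one, one_smul, smulForm]
  · exact smulForm_eq_zero_of_eq_zero θ (P.weight_eq_zero j hz)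
  · simp only [smulForm]
    rw [← Finset.sum_smul, ← Complex.ofReal_sum, P.sum_weight z (hK hz), Complex.ofReal_one,
      one_smul]

lemma AdaptedPartition.sum_chartFibreIntegral_eq_fibreIntegral {θ : FormField (n + 1) Z (2 * n)}
    (hθ : FibreContinuous f θ) {K : Set Z} (P : AdaptedPartition (n := n) f K) {s : ℂ}
    (hK : f ⁻¹' {s} ⊆ K) (hs : Nonempty (AdaptedPartition (n := n) f (f ⁻¹' {s}))) :
    ∑ j, chartFibreIntegral θ (P.chart j) (P.weight j) s = fibreIntegral f θ s := by
  rw [fibreIntegral, dif_pos hs]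
  exact P.sum_chartFibreIntegral_eq_sum hθ _ hK subset_rfl

end Independence

/-! ### Differentiation under the fibre integral. -/

section FibreIntegrationAnalysis

open MeasureTheory

variable {n : ℕ}

/-- The inclusion of the horizontal directions. -/
noncomputable def horizontalIncl (n : ℕ) : ℂ →L[ℝ] (Fin (n + 1) → ℂ) :=
  ContinuousLinearMap.single ℝ (fun _ => ℂ) 0

lemma horizontalIncl_apply (u : ℂ) : horizontalIncl n u = Fin.cons u 0 := by
  funext i
  refine Fin.cases ?_ (fun j => ?_) i <;> simp [horizontalIncl]

lemma hasFDerivAt_cons_left (s : ℂ) (w : Fin n → ℂ) :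
    HasFDerivAt (𝕜 := ℝ) (fun s => (Fin.cons s w : Fin (n + 1) → ℂ)) (horizontalIncl n) s := by
  have h : (fun s => (Fin.cons s w : Fin (n + 1) → ℂ)) =
      fun s => horizontalIncl n s + Fin.cons 0 w := by
    funext s i
    refine Fin.cases ?_ (fun j => ?_) i <;> simp [horizontalIncl]
  rw [h]
  exact (horizontalIncl n).hasFDerivAt.add_const _

variable {F : Type*} [NormedAddCommGroup F]

lemma integrable_comp_cons {g : (Fin (n + 1) → ℂ) → F} (hg : Continuous g)
    (hc : HasCompactSupport g) (s : ℂ) : Integrable fun w : Fin n → ℂ => g (Fin.cons s w) :=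
  (hg.comp (continuous_cons_left s)).integrable_of_hasCompactSupport
    (hc.comp_isClosedEmbedding (isClosedEmbedding_cons s))

/-- The bound is a constant on the projection of the support. It does not depend on `s`, as both
dominated differentiation and Fubini require. -/
lemma exists_integrable_bound_comp_cons {g : (Fin (n + 1) → ℂ) → F} (hg : Continuous g)
    (hc : HasCompactSupport g) :
    ∃ b : (Fin n → ℂ) → ℝ, Integrable b ∧ ∀ s w, ‖g (Fin.cons s w)‖ ≤ b w := by
  obtain ⟨C, hC⟩ := hg.bounded_above_of_compact_support hc
  have hK : IsCompact (tailProj n '' tsupport g) := hc.isCompact.image (tailProj n).continuous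
  refine ⟨(tailProj n '' tsupport g).indicator fun _ => C,
    (integrable_indicator_iff hK.measurableSet).2 (integrableOn_const hK.measure_ne_top), ?_⟩
  intro s w
  by_cases hw : (Fin.cons s w : Fin (n + 1) → ℂ) ∈ tsupport g
  · have hm : w ∈ tailProj n '' tsupport g := ⟨_, hw, by simp⟩
    rw [Set.indicator_of_mem hm]
    exact hC _
  · rw [image_eq_zero_of_notMem_tsupport hw, norm_zero]
    refine Set.indicator_nonneg (fun _ _ => ?_) _
    exact (norm_nonneg _).trans (hC 0)

variable {g : (Fin (n + 1) → ℂ) → ℂ} (hg : ContDiff ℝ 1 g) (hc : HasCompactSupport g)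

include hg

lemma continuous_fderiv_apply_of_contDiff (v : Fin (n + 1) → ℂ) :
    Continuous fun y => fderiv ℝ g y v :=
  (hg.continuous_fderiv (by simp)).clm_apply continuous_const

include hc

omit hg in
lemma hasCompactSupport_fderiv_apply (v : Fin (n + 1) → ℂ) :
    HasCompactSupport fun y => fderiv ℝ g y v :=
  hc.fderiv_apply (𝕜 := ℝ) v

/-- Differentiation under the integral over the fibres. -/
lemma hasFDerivAt_integral_cons (s : ℂ) :
    HasFDerivAt (fun s => ∫ w : Fin n → ℂ, g (Fin.cons s w))
      (∫ w : Fin n → ℂ, (fderiv ℝ g (Fin.cons s w)).comp (horizontalIncl n)) s := by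
  have hcont : Continuous fun y => (fderiv ℝ g y).comp (horizontalIncl n) :=
    (hg.continuous_fderiv (by simp)).clm_comp continuous_const
  have hcs : HasCompactSupport fun y => (fderiv ℝ g y).comp (horizontalIncl n) :=
    (hc.fderiv (𝕜 := ℝ)).comp_left (g := fun L : (Fin (n + 1) → ℂ) →L[ℝ] ℂ =>
      L.comp (horizontalIncl n)) (ContinuousLinearMap.zero_comp _)
  obtain ⟨b, hb, hle⟩ := exists_integrable_bound_comp_cons hcont hcs
  refine hasFDerivAt_integral_of_dominated_of_fderiv_le (𝕜 := ℝ) (s := Set.univ) (bound := b)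
    (F := fun s w => g (Fin.cons s w))
    (F' := fun s w => (fderiv ℝ g (Fin.cons s w)).comp (horizontalIncl n)) Filter.univ_mem
    ?_ ?_ ?_ ?_ hb ?_
  · exact Filter.Eventually.of_forall fun s =>
      (integrable_comp_cons hg.continuous hc s).aestronglyMeasurable
  · exact integrable_comp_cons hg.continuous hc s
  · exact (integrable_comp_cons hcont hcs s).aestronglyMeasurable
  · exact Filter.Eventually.of_forall fun w s _ => hle s w
  · exact Filter.Eventually.of_forall fun w s _ =>
      ((hg.differentiable (by simp)) _).hasFDerivAt.comp s (hasFDerivAt_cons_left s w)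

lemma fderiv_integral_cons_apply (s u : ℂ) :
    fderiv ℝ (fun s => ∫ w : Fin n → ℂ, g (Fin.cons s w)) s u =
      ∫ w : Fin n → ℂ, fderiv ℝ g (Fin.cons s w) (Fin.cons u 0) := by
  rw [(hasFDerivAt_integral_cons hg hc s).fderiv, ContinuousLinearMap.integral_apply]
  · simp only [ContinuousLinearMap.comp_apply, horizontalIncl_apply]
  · exact integrable_comp_cons ((hg.continuous_fderiv (by simp)).clm_comp continuous_const)
      ((hc.fderiv (𝕜 := ℝ)).comp_left (g := fun L : (Fin (n + 1) → ℂ) →L[ℝ] ℂ =>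
        L.comp (horizontalIncl n)) (ContinuousLinearMap.zero_comp _)) s

/-- The vertical derivatives of a function with compact support have integral zero. -/
lemma integral_fderiv_cons_zero_eq_zero (s : ℂ) (u : Fin n → ℂ) :
    ∫ w : Fin n → ℂ, fderiv ℝ g (Fin.cons s w) (Fin.cons 0 u) = 0 := by
  have h1 : ∀ w : Fin n → ℂ, HasFDerivAt (fun w => g (Fin.cons s w))
      ((fderiv ℝ g (Fin.cons s w)).comp ((verticalIncl n).restrictScalars ℝ)) w := fun w =>
    ((hg.differentiable (by simp)) _).hasFDerivAt.comp w
      ((hasFDerivAt_cons s w).restrictScalars ℝ)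
  have h2 : ∀ w : Fin n → ℂ, fderiv ℝ (fun w => g (Fin.cons s w)) w u =
      fderiv ℝ g (Fin.cons s w) (Fin.cons 0 u) := fun w => by
    rw [(h1 w).fderiv]; rfl
  -- Integration by parts against the constant function 1.
  have h3 := integral_mul_fderiv_eq_neg_fderiv_mul_of_integrable (μ := volume)
    (f := fun _ : Fin n → ℂ => (1 : ℂ)) (g := fun w : Fin n → ℂ => g (Fin.cons s w)) (v := u)
    (by simp) (by
      simp only [h2, one_mul]
      exact integrable_comp_cons (continuous_fderiv_apply_of_contDiff hg _)
        (hasCompactSupport_fderiv_apply hc _) s)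
    (by simpa using integrable_comp_cons hg.continuous hc s)
    (fun _ _ => differentiableAt_const _) (fun w _ => (h1 w).differentiableAt)
  simpa [h2] using h3

end FibreIntegrationAnalysis

/-! ### Stokes' formula along the fibres. -/

section Stokes

open MeasureTheory

variable {n : ℕ}

/-- Stokes' formula for the integral over the fibres of a form with compact support. -/
lemma integral_extDeriv_cons
    {Ω : (Fin (n + 1) → ℂ) → (Fin (n + 1) → ℂ) [⋀^Fin (2 * n + 1)]→L[ℝ] ℂ}
    (hΩ : ContDiff ℝ 1 Ω) (hc : HasCompactSupport Ω) (s a b : ℂ) :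
    ∫ w : Fin n → ℂ, extDeriv Ω (Fin.cons s w)
        (Fin.cons (Fin.cons a 0) (Fin.cons (Fin.cons b 0) (verticalFrame n))) =
      fderiv ℝ (fun s => ∫ w : Fin n → ℂ,
        Ω (Fin.cons s w) (Fin.cons (Fin.cons b 0) (verticalFrame n))) s a -
      fderiv ℝ (fun s => ∫ w : Fin n → ℂ,
        Ω (Fin.cons s w) (Fin.cons (Fin.cons a 0) (verticalFrame n))) s b := by
  have hev : ∀ v, ContDiff ℝ 1 fun y => Ω y v := fun v =>
    contDiff_iff_contDiffAt.2 fun y => contDiffAt_continuousAlternatingMap_iff.1 hΩ.contDiffAt v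
  have hcev : ∀ v, HasCompactSupport fun y => Ω y v := fun v =>
    hc.comp_left (g := fun A : (Fin (n + 1) → ℂ) [⋀^Fin (2 * n + 1)]→L[ℝ] ℂ => A v) rfl
  have hint : ∀ v x, Integrable fun w : Fin n → ℂ => fderiv ℝ (fun y => Ω y v) (Fin.cons s w) x :=
    fun v x => integrable_comp_cons (continuous_fderiv_apply_of_contDiff (hev v) x)
      (hasCompactSupport_fderiv_apply (hcev v) x) s
  set v : Fin (2 * n + 1 + 1) → Fin (n + 1) → ℂ :=
    Fin.cons (Fin.cons a 0) (Fin.cons (Fin.cons b 0) (verticalFrame n)) with hv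
  have h0 : Fin.removeNth 0 v = Fin.cons (Fin.cons b 0) (verticalFrame n) := by
    rw [hv, Fin.removeNth_zero, Fin.tail_cons]
  have h1 : Fin.removeNth (Fin.succ 0) v = Fin.cons (Fin.cons a 0) (verticalFrame n) := by
    funext j
    refine Fin.cases ?_ (fun j => ?_) j
    · simp [hv, Fin.removeNth]
    · simp [hv, Fin.removeNth]
  -- The terms of the exterior derivative are separated by direction of differentiation. The two
  -- horizontal ones become derivatives in `s` of fibre integrals; the vertical ones integrate to
  -- zero by compact support.
  have hsum : ∀ w : Fin n → ℂ, extDeriv Ω (Fin.cons s w) v =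
      fderiv ℝ (fun y => Ω y (Fin.cons (Fin.cons b 0) (verticalFrame n))) (Fin.cons s w)
        (Fin.cons a 0) -
      fderiv ℝ (fun y => Ω y (Fin.cons (Fin.cons a 0) (verticalFrame n))) (Fin.cons s w)
        (Fin.cons b 0) +
      ∑ k : Fin (2 * n), (-1 : ℂ) ^ (k : ℕ) * fderiv ℝ (fun y => Ω y (Fin.removeNth k.succ.succ v))
        (Fin.cons s w) (Fin.cons 0 (realFrame n k)) := by
    intro w
    rw [extDeriv_apply ((hΩ.differentiable (by simp)) _), Fin.sum_univ_succ, Fin.sum_univ_succ, h0,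
      h1, ← add_assoc, sub_eq_add_neg]
    refine congrArg₂ (· + ·) (congrArg₂ (· + ·) ?_ ?_) (Finset.sum_congr rfl fun k _ => ?_)
    · simp [hv]
    · simp [hv]
    · simp [hv, pow_succ, verticalFrame]
  simp only [hsum]
  refine (integral_add ((hint _ _).sub (hint _ _))
      (integrable_finsetSum _ fun k _ => (hint _ _).const_mul _)).trans ?_
  rw [integral_finsetSum _ fun k _ => (hint _ _).const_mul _]
  simp only [Pi.sub_apply]
  rw [integral_sub (hint _ _) (hint _ _),
    fderiv_integral_cons_apply (hev _) (hcev _), fderiv_integral_cons_apply (hev _) (hcev _)]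
  have hz : ∀ k : Fin (2 * n), ∫ w : Fin n → ℂ, (-1 : ℂ) ^ (k : ℕ) *
      fderiv ℝ (fun y => Ω y (Fin.removeNth k.succ.succ v)) (Fin.cons s w)
        (Fin.cons 0 (realFrame n k)) = 0 := fun k => by
    rw [integral_const_mul, integral_fderiv_cons_zero_eq_zero (hev _) (hcev _), mul_zero]
  simp only [hz, Finset.sum_const_zero, add_zero]

end Stokes

/-! ### Evaluation on vertical vectors. -/

section VerticalVectors

variable {n : ℕ}

/-- An alternating form vanishes when more than `2n` of its arguments are vertical. -/
lemma ContinuousAlternatingMap.map_eq_zero_of_vertical {d : ℕ}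
    (B : (Fin (n + 1) → ℂ) [⋀^Fin d]→L[ℝ] ℂ) {v : Fin d → Fin (n + 1) → ℂ}
    {σ : Fin (2 * n + 1) → Fin d} (hσ : Function.Injective σ) (hv : ∀ k, v (σ k) 0 = 0) :
    B v = 0 := by
  refine B.toAlternatingMap.map_linearDependent v fun hli => ?_
  have h1 := hli.comp σ hσ
  have h2 : v ∘ σ = ((verticalIncl n).restrictScalars ℝ).toLinearMap ∘
      fun k => Fin.tail (v (σ k)) := by
    funext k
    change v (σ k) = Fin.cons 0 (Fin.tail (v (σ k)))
    rw [← hv k, Fin.cons_self_tail]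
  rw [h2] at h1
  have h3 := (LinearIndependent.of_comp _ h1).fintype_card_le_finrank
  rw [finrank_real_fin_complex, Fintype.card_fin] at h3
  omega

/-- The vertical part of `x` or `y` contributes a term with `2n + 1` vertical arguments, which
vanishes. Hence the value depends only on the images of `x` and `y` in the base. -/
lemma ContinuousAlternatingMap.map_cons_cons_verticalFrame
    (B : (Fin (n + 1) → ℂ) [⋀^Fin (2 * n + 1 + 1)]→L[ℝ] ℂ) (x y : Fin (n + 1) → ℂ) :
    B (Fin.cons x (Fin.cons y (verticalFrame n))) =
      B (Fin.cons (Fin.cons (x 0) 0) (Fin.cons (Fin.cons (y 0) 0) (verticalFrame n))) := by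
  have hdec : ∀ x : Fin (n + 1) → ℂ, x = Fin.cons (x 0) 0 + Fin.cons 0 (Fin.tail x) := fun x => by
    funext i
    refine Fin.cases ?_ (fun j => ?_) i <;> simp [Fin.tail]
  have h1 : B (Fin.cons x (Fin.cons y (verticalFrame n))) =
      B (Fin.cons (Fin.cons (x 0) 0) (Fin.cons y (verticalFrame n))) := by
    conv_lhs => rw [hdec x, B.cons_add]
    -- `Fin.succAbove 1` skips only the slot of `y`, which need not be vertical, and keeps `2n + 1`
    -- vertical arguments.
    rw [B.map_eq_zero_of_vertical (v := Fin.cons (Fin.cons 0 (Fin.tail x))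
      (Fin.cons y (verticalFrame n))) (σ := Fin.succAbove 1) Fin.succAbove_right_injective, add_zero]
    intro k
    refine Fin.cases ?_ (fun j => ?_) k
    · simp
    · simp [verticalFrame]
  have h2 : B (Fin.cons (Fin.cons (x 0) 0) (Fin.cons y (verticalFrame n))) =
      B (Fin.cons (Fin.cons (x 0) 0) (Fin.cons (Fin.cons (y 0) 0) (verticalFrame n))) := by
    have h3 : ∀ z, B (Fin.cons (Fin.cons (x 0) 0) (Fin.cons z (verticalFrame n))) =
        B.curryLeft (Fin.cons (x 0) 0) (Fin.cons z (verticalFrame n)) := fun z => rfl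
    rw [h3, h3]
    conv_lhs => rw [hdec y, ContinuousAlternatingMap.cons_add]
    rw [(B.curryLeft _).map_eq_zero_of_vertical
      (v := Fin.cons (Fin.cons 0 (Fin.tail y)) (verticalFrame n)) (σ := id) Function.injective_id, add_zero]
    intro k
    refine Fin.cases ?_ (fun j => ?_) k
    · simp
    · simp [verticalFrame]
  rw [h1, h2]

end VerticalVectors

/-! ### The exterior derivative in arbitrary charts, and closed forms. -/

section ExteriorDerivative

variable {m k : ℕ} {M : Type*} [TopologicalSpace M] [ChartedSpace (Fin m → ℂ) M]

lemma extDerivForm_congr {α β : FormField m M k} {x : M} (h : ∀ᶠ z in nhds x, α z = β z) :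
    extDerivForm α x = extDerivForm β x := by
  refine Filter.EventuallyEq.extDeriv_eq ?_
  have hc := (chartAt (Fin m → ℂ) x).continuousAt_symm (mem_chart_target _ x)
  rw [ContinuousAt, (chartAt (Fin m → ℂ) x).left_inv (mem_chart_source _ x)] at hc
  filter_upwards [hc.eventually h] with y hy
  simp only [coordForm, hy]

lemma extDerivForm_zero : extDerivForm (0 : FormField m M k) = 0 :=
  (extDerivLin m M k).map_zero

omit [TopologicalSpace M] [ChartedSpace (Fin m → ℂ) M] in
lemma sum_formField_apply {ι : Type*} (I : Finset ι) (α : ι → FormField m M k) (x : M) :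
    (∑ i ∈ I, α i) x = ∑ i ∈ I, α i x :=
  Finset.sum_apply x I (fun i => (α i : M → (Fin m → ℂ) [⋀^Fin k]→L[ℝ] ℂ))

lemma extDerivForm_sum {ι : Type*} (I : Finset ι) {α : ι → FormField m M k}
    (hα : ∀ i, α i ∈ smoothForms m M k) :
    extDerivForm (∑ i ∈ I, α i) = ∑ i ∈ I, extDerivForm (α i) := by
  have h := map_sum (extDerivLin m M k) (fun i => (⟨α i, hα i⟩ : smoothForms m M k)) I
  have h2 : ((∑ i ∈ I, (⟨α i, hα i⟩ : smoothForms m M k) : smoothForms m M k) : FormField m M k) =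
      ∑ i ∈ I, α i := by
    rw [Submodule.coe_sum]
  change extDerivForm ((∑ i ∈ I, (⟨α i, hα i⟩ : smoothForms m M k) : smoothForms m M k) :
    FormField m M k) = ∑ i ∈ I, extDerivForm (α i) at h
  rwa [h2] at h

lemma mem_closedForms_iff {α : FormField m M k} :
    α ∈ closedForms m M k ↔ α ∈ smoothForms m M k ∧ extDerivForm α = 0 := by
  constructor
  · rintro ⟨β, hβ, rfl⟩
    exact ⟨β.2, hβ⟩
  · rintro ⟨h1, h2⟩
    exact ⟨⟨α, h1⟩, h2, rfl⟩

variable [IsManifold 𝓘(ℂ, Fin m → ℂ) ω M]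

/-- Compatibility with pull-back along the identity frees the exterior derivative from the preferred
charts of its definition. -/
lemma coordForm_extDerivForm {α : FormField m M k} (hα : α ∈ smoothForms m M k)
    {φ : OpenPartialHomeomorph M (Fin m → ℂ)}
    (hφ : φ ∈ IsManifold.maximalAtlas 𝓘(ℂ, Fin m → ℂ) ω M) {y : Fin m → ℂ} (hy : y ∈ φ.target) :
    coordForm (extDerivForm α) φ y = extDeriv (coordForm α φ) y := by
  have h := extDeriv_coordForm_pullbackForm (g := (id : M → M)) mdifferentiable_id hα hφ hy
  rw [pullbackForm_id, pullbackForm_id] at h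
  exact h.symm

lemma pullbackForm_mem_closedForms {m' : ℕ} {M' : Type*} [TopologicalSpace M']
    [ChartedSpace (Fin m' → ℂ) M'] [IsManifold 𝓘(ℂ, Fin m' → ℂ) ω M'] {g : M → M'}
    (hg : MDifferentiable 𝓘(ℂ, Fin m → ℂ) 𝓘(ℂ, Fin m' → ℂ) g) {α : FormField m' M' k}
    (hα : α ∈ closedForms m' M' k) : pullbackForm g α ∈ closedForms m M k := by
  rw [mem_closedForms_iff] at hα ⊢
  refine ⟨pullbackForm_mem_smoothForms hg hα.1, funext fun x => ?_⟩
  refine (extDeriv_coordForm_pullbackForm hg hα.1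
    (IsManifold.chart_mem_maximalAtlas x) (mem_chart_target _ x)).trans ?_
  rw [hα.2]
  rfl

omit [IsManifold 𝓘(ℂ, Fin m → ℂ) ω M] in
lemma tangentMapAt_symm_tangentMapAt {φ : OpenPartialHomeomorph M (Fin m → ℂ)}
    (hφ : φ ∈ IsManifold.maximalAtlas 𝓘(ℂ, Fin m → ℂ) ω M) {y : Fin m → ℂ} (hy : y ∈ φ.target)
    (u : Fin m → ℂ) :
    tangentMapAt (m := m) (m' := m) φ.symm y
      (tangentMapAt (m := m) (m' := m) φ (φ.symm y) u) = u := by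
  have h1 := (contMDiffAt_of_mem_maximalAtlas hφ (φ.map_target hy)).mdifferentiableAt (by simp)
  have h2 := (contMDiffAt_symm_of_mem_maximalAtlas hφ hy).mdifferentiableAt (by simp)
  nth_rewrite 1 [← φ.right_inv hy] at h2
  have h3 := tangentMapAt_comp h2 h1
  have h4 : φ.symm ∘ φ =ᶠ[nhds (φ.symm y)] id := φ.eventually_left_inverse (φ.map_target hy)
  rw [tangentMapAt_congr h4, tangentMapAt_id, φ.right_inv hy] at h3
  exact (DFunLike.congr_fun h3 u).symm

lemma continuousOn_extDeriv_coordForm {α : FormField m M k} (hα : α ∈ smoothForms m M k)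
    {φ : OpenPartialHomeomorph M (Fin m → ℂ)}
    (hφ : φ ∈ IsManifold.maximalAtlas 𝓘(ℂ, Fin m → ℂ) ω M) (v : Fin (k + 1) → Fin m → ℂ) :
    ContinuousOn (fun y => extDeriv (coordForm α φ) y v) φ.target := by
  intro y hy
  have h1 : ContDiffAt ℝ 0 (fderiv ℝ (coordForm α φ)) y :=
    (contDiffAt_coordForm hα hφ hy).fderiv_right (by simp)
  have h2 : ContDiffAt ℝ 0 (fun y => ContinuousAlternatingMap.alternatizeUncurryFinCLM ℝ _ ℂ
      (fderiv ℝ (coordForm α φ) y)) y :=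
    (ContinuousLinearMap.contDiff _).contDiffAt.comp y h1
  exact (contDiffAt_continuousAlternatingMap_iff.1 h2 v).continuousAt.continuousWithinAt

end ExteriorDerivative

/-! ### Holomorphy of the fibre integrals. -/

section Holomorphy

variable {n : ℕ} {Z : Type*} [TopologicalSpace Z] [ChartedSpace (Fin (n + 1) → ℂ) Z]
  {f : Z → ℂ} {φ : OpenPartialHomeomorph Z (Fin (n + 1) → ℂ)}

lemma fibreContinuous_of_mem_smoothForms [IsManifold 𝓘(ℂ, Fin (n + 1) → ℂ) ω Z]
    {θ : FormField (n + 1) Z (2 * n)}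
    (hθ : θ ∈ smoothForms (n + 1) Z (2 * n)) : FibreContinuous f θ := fun _ hφ _ hy =>
  (contDiffAt_continuousAlternatingMap_iff.1 (contDiffAt_coordForm hθ hφ.mem_maximalAtlas hy)
    (verticalFrame n)).continuousAt.continuousWithinAt

section GelfandLerayCoord

variable [IsManifold 𝓘(ℂ, Fin (n + 1) → ℂ) ω Z]
  {η : FormField (n + 1) Z (2 * n + 1)} {θ : FormField (n + 1) Z (2 * n)}

/-- In `df ∧ θ` only the term with `df` applied to `x` survives, as `df` kills the vertical frame.
-/
lemma IsGelfandLeray.coordForm_cons (hf : MDifferentiable 𝓘(ℂ, Fin (n + 1) → ℂ) 𝓘(ℂ, ℂ) f)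
    (hθ : IsGelfandLeray f η θ) (hφ : IsAdaptedChart f φ)
    {y : Fin (n + 1) → ℂ} (hy : y ∈ φ.target) (x : Fin (n + 1) → ℂ) :
    coordForm η φ y (Fin.cons x (verticalFrame n)) = x 0 * coordForm θ φ y (verticalFrame n) := by
  rw [coordForm, ContinuousAlternatingMap.compContinuousLinearMap_apply, hθ.2, Fin.sum_univ_succ,
    Finset.sum_eq_zero, add_zero]
  · simp only [Function.comp_apply, ContinuousLinearMap.coe_restrictScalars']
    rw [hφ.differentialAt_tangentMapAt hf hy]
    simp only [Fin.cons_zero, Fin.val_zero, pow_zero, one_mul]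
    rfl
  · intro i _
    simp only [Function.comp_apply, ContinuousLinearMap.coe_restrictScalars']
    rw [hφ.differentialAt_tangentMapAt hf hy]
    simp [verticalFrame]

end GelfandLerayCoord

/-- A form multiplied by a weight, in a chart, extended by zero. -/
noncomputable def extendedForm {k : ℕ} (η : FormField (n + 1) Z k)
    (φ : OpenPartialHomeomorph Z (Fin (n + 1) → ℂ)) (ρ : Z → ℝ) :
    (Fin (n + 1) → ℂ) → (Fin (n + 1) → ℂ) [⋀^Fin k]→L[ℝ] ℂ :=
  φ.target.indicator (coordForm (smulForm ρ η) φ)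

section ExtendedForm

variable {k : ℕ} {η : FormField (n + 1) Z k} {ρ : Z → ℝ}

lemma extendedForm_aux : ∀ y ∈ φ.target, y ∉ φ '' tsupport ρ →
    coordForm (smulForm ρ η) φ y = 0 := by
  intro y hy hyC
  have h1 : φ.symm y ∉ tsupport ρ := fun h => hyC ⟨_, h, φ.right_inv hy⟩
  rw [coordForm_smulForm, image_eq_zero_of_notMem_tsupport h1, Complex.ofReal_zero]
  exact zero_smul ℂ (coordForm η φ y)

lemma contDiff_extendedForm [IsManifold 𝓘(ℂ, Fin (n + 1) → ℂ) ω Z]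
    (hφ : φ ∈ IsManifold.maximalAtlas 𝓘(ℂ, Fin (n + 1) → ℂ) ω Z)
    (hη : η ∈ smoothForms (n + 1) Z k) (hρ : ContMDiff 𝓘(ℝ, Fin (n + 1) → ℂ) 𝓘(ℝ, ℝ) ∞ ρ)
    (hc : HasCompactSupport ρ) (hs : tsupport ρ ⊆ φ.source) :
    ContDiff ℝ ∞ (extendedForm η φ ρ) :=
  contDiff_indicator_of_isClosed φ.open_target (isCompact_image_chart hc hs).isClosed
    (image_chart_subset_target hs) extendedForm_aux fun _ hy =>
      contDiffAt_coordForm_smulForm hρ hφ hy (contDiffAt_coordForm hη hφ hy)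

lemma hasCompactSupport_extendedForm (hc : HasCompactSupport ρ) (hs : tsupport ρ ⊆ φ.source) :
    HasCompactSupport (extendedForm η φ ρ) :=
  hasCompactSupport_indicator (isCompact_image_chart hc hs) extendedForm_aux

lemma extDeriv_extendedForm (hc : HasCompactSupport ρ) (hs : tsupport ρ ⊆ φ.source)
    (y : Fin (n + 1) → ℂ) :
    extDeriv (extendedForm η φ ρ) y =
      φ.target.indicator (extDeriv (coordForm (smulForm ρ η) φ)) y := by
  by_cases hy : y ∈ φ.target
  · rw [Set.indicator_of_mem hy]
    exact (indicator_eventuallyEq_of_isOpen φ.open_target hy).extDeriv_eq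
  · rw [Set.indicator_of_notMem hy]
    have h : extendedForm η φ ρ =ᶠ[nhds y] fun _ => 0 :=
      indicator_eventuallyEq_zero_of_notMem (isCompact_image_chart hc hs).isClosed
        extendedForm_aux fun h => hy (image_chart_subset_target hs h)
    rw [h.extDeriv_eq, extDeriv, fderiv_fun_const]
    exact (ContinuousAlternatingMap.alternatizeUncurryFinCLM ℝ _ ℂ).map_zero

end ExtendedForm

/-- The contraction of a form of degree `2n + 2` with `h` and `I • h`. -/
noncomputable def contractTwice (h : Z → Fin (n + 1) → ℂ)
    (β : FormField (n + 1) Z (2 * n + 1 + 1)) : FormField (n + 1) Z (2 * n) :=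
  fun z => ((β z).curryLeft (h z)).curryLeft (Complex.I • h z)

variable [IsManifold 𝓘(ℂ, Fin (n + 1) → ℂ) ω Z]

/-- In the chart, `h` has first component 1, so it differs from the first coordinate vector by a
vertical one, which does not affect the value. -/
lemma coordForm_contractTwice (hf : MDifferentiable 𝓘(ℂ, Fin (n + 1) → ℂ) 𝓘(ℂ, ℂ) f)
    (hφ : IsAdaptedChart f φ) {h : Z → Fin (n + 1) → ℂ}
    (hh : ∀ z, differentialAt f z (h z) = 1) (β : FormField (n + 1) Z (2 * n + 1 + 1))
    {y : Fin (n + 1) → ℂ} (hy : y ∈ φ.target) :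
    coordForm (contractTwice h β) φ y (verticalFrame n) =
      coordForm β φ y
        (Fin.cons (Fin.cons 1 0) (Fin.cons (Fin.cons Complex.I 0) (verticalFrame n))) := by
  set x := tangentMapAt (m := n + 1) (m' := n + 1) φ (φ.symm y) (h (φ.symm y)) with hx
  have h1 := tangentMapAt_symm_tangentMapAt hφ.mem_maximalAtlas hy (h (φ.symm y))
  rw [← hx] at h1
  have h2 : x 0 = 1 := by
    rw [← hφ.differentialAt_tangentMapAt hf hy x, h1, hh]
  have h3 := ContinuousAlternatingMap.map_cons_cons_verticalFrame (coordForm β φ y) x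
    (Complex.I • x)
  rw [Pi.smul_apply, h2, smul_eq_mul, mul_one] at h3
  rw [← h3]
  change β (φ.symm y) (Fin.cons (h (φ.symm y)) (Fin.cons (Complex.I • h (φ.symm y)) _)) =
    β (φ.symm y) _
  congr 1
  funext i
  refine Fin.cases ?_ (fun i => Fin.cases ?_ (fun i => ?_) i) i
  · simp [h1]
  · simp [h1]
  · simp

/-- The field `h` need not be continuous, nor then the contracted form; but its restriction to the
fibres does not see the choice of lift. This is why continuity is only demanded along the vertical
frame. -/
lemma fibreContinuous_contractTwice_extDerivForm
    (hf : MDifferentiable 𝓘(ℂ, Fin (n + 1) → ℂ) 𝓘(ℂ, ℂ) f) {h : Z → Fin (n + 1) → ℂ}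
    (hh : ∀ z, differentialAt f z (h z) = 1) {α : FormField (n + 1) Z (2 * n + 1)}
    (hα : α ∈ smoothForms (n + 1) Z (2 * n + 1)) :
    FibreContinuous f (contractTwice h (extDerivForm α)) := by
  intro φ hφ
  refine (continuousOn_extDeriv_coordForm hα hφ.mem_maximalAtlas (Fin.cons (Fin.cons 1 0)
    (Fin.cons (Fin.cons Complex.I 0) (verticalFrame n)))).congr fun y hy => ?_
  beta_reduce
  rw [← coordForm_extDerivForm hα hφ.mem_maximalAtlas hy]
  exact coordForm_contractTwice hf hφ hh _ hy

/-- Integrated over the slice, this says that fibre integration takes `ρ η` to the 1-form `J ds`,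
with `J` the contribution of `ρ θ`. -/
lemma IsGelfandLeray.extendedForm_cons {η : FormField (n + 1) Z (2 * n + 1)}
    {θ : FormField (n + 1) Z (2 * n)}
    (hf : MDifferentiable 𝓘(ℂ, Fin (n + 1) → ℂ) 𝓘(ℂ, ℂ) f)
    (hθ : IsGelfandLeray f η θ) (hφ : IsAdaptedChart f φ) (ρ : Z → ℝ) (y : Fin (n + 1) → ℂ)
    (u : ℂ) :
    extendedForm η φ ρ y (Fin.cons (Fin.cons u 0) (verticalFrame n)) =
      u * fibreDensity θ φ ρ y := by
  by_cases hy : y ∈ φ.target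
  · rw [extendedForm, fibreDensity, Set.indicator_of_mem hy, Set.indicator_of_mem hy,
      coordForm_smulForm, ContinuousAlternatingMap.smul_apply, hθ.coordForm_cons hf hφ hy,
      Fin.cons_zero, smul_eq_mul]
    ring
  · rw [extendedForm, fibreDensity, Set.indicator_of_notMem hy, Set.indicator_of_notMem hy,
      mul_zero]
    rfl

/-- The fibre integrals of a Gelfand–Leray form of a closed form depend holomorphically on the
fibre. -/
lemma differentiableAt_sum_chartFibreIntegral {η : FormField (n + 1) Z (2 * n + 1)}
    {θ : FormField (n + 1) Z (2 * n)}
    (hf : MDifferentiable 𝓘(ℂ, Fin (n + 1) → ℂ) 𝓘(ℂ, ℂ) f)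
    (hfs : ∀ z, Function.Surjective (differentialAt (m := n + 1) f z))
    (hη : η ∈ closedForms (n + 1) Z (2 * n + 1)) (hθ : IsGelfandLeray f η θ) {K : Set Z}
    (P : AdaptedPartition (n := n) f K)
    (hP : ∀ j, ContMDiff 𝓘(ℝ, Fin (n + 1) → ℂ) 𝓘(ℝ, ℝ) ∞ (P.weight j)) {s : ℂ}
    (hK : ∀ z, f z = s → K ∈ nhds z) :
    DifferentiableAt ℂ (fun s => ∑ j, chartFibreIntegral θ (P.chart j) (P.weight j) s) s := by
  rw [mem_closedForms_iff] at hη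
  -- Lifts of `1 ∈ ℂ`, chosen pointwise without any regularity. A single choice for all charts makes
  -- the contractions forms on `Z`, so that they can be added.
  choose h hh using fun z => hfs z 1
  let Ω := fun j => extendedForm η (P.chart j) (P.weight j)
  have hΩ : ∀ j, ContDiff ℝ 1 (Ω j) := fun j => (contDiff_extendedForm (P.chart_mem j) hη.1 (hP j)
    (P.hasCompactSupport_weight j) (P.tsupport_subset j)).of_le (by simp)
  have hΩc : ∀ j, HasCompactSupport (Ω j) := fun j =>
    hasCompactSupport_extendedForm (P.hasCompactSupport_weight j) (P.tsupport_subset j)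
  have hΩv : ∀ j u s, ∫ w : Fin n → ℂ, Ω j (Fin.cons s w)
      (Fin.cons (Fin.cons u 0) (verticalFrame n)) =
      u * chartFibreIntegral θ (P.chart j) (P.weight j) s := fun j u s => by
    rw [chartFibreIntegral_eq_integral, ← MeasureTheory.integral_const_mul]
    simp only [Ω, hθ.extendedForm_cons hf (P.isAdaptedChart j)]
  have hd : ∀ j, DifferentiableAt ℝ (chartFibreIntegral θ (P.chart j) (P.weight j)) s := by
    intro j
    have h1 := (hasFDerivAt_integral_cons (g := fun y => Ω j y (Fin.cons (Fin.cons 1 0)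
      (verticalFrame n))) (contDiff_iff_contDiffAt.2 fun y =>
        contDiffAt_continuousAlternatingMap_iff.1 (hΩ j).contDiffAt _)
      ((hΩc j).comp_left (g := fun A : (Fin (n + 1) → ℂ) [⋀^Fin (2 * n + 1)]→L[ℝ] ℂ => A _)
        rfl) s).differentiableAt
    simpa only [hΩv, one_mul] using h1
  let ξ := fun j => contractTwice h (extDerivForm (smulForm (P.weight j) η))
  have hsm : ∀ j, smulForm (P.weight j) η ∈ smoothForms (n + 1) Z (2 * n + 1) := fun j =>
    smulForm_mem_smoothForms (hP j) hη.1
  -- Stokes' formula in the directions `1` and `I`. The weight is the constant 1 because the cut-off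
  -- is already inside the form.
  have hξ : ∀ j, chartFibreIntegral (ξ j) (P.chart j) (fun _ => 1) s =
      Complex.I * fderiv ℝ (chartFibreIntegral θ (P.chart j) (P.weight j)) s 1 -
        fderiv ℝ (chartFibreIntegral θ (P.chart j) (P.weight j)) s Complex.I := by
    intro j
    have h1 := integral_extDeriv_cons (hΩ j) (hΩc j) s 1 Complex.I
    simp only [hΩv, one_mul] at h1
    rw [fderiv_const_mul (hd j)] at h1
    rw [chartFibreIntegral_eq_integral]
    refine Eq.trans (MeasureTheory.integral_congr_ae (Filter.Eventually.of_forall fun w => ?_)) h1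
    simp only [Ω]
    rw [extDeriv_extendedForm (P.hasCompactSupport_weight j) (P.tsupport_subset j), fibreDensity]
    by_cases hy : (Fin.cons s w : Fin (n + 1) → ℂ) ∈ (P.chart j).target
    · rw [Set.indicator_of_mem hy, Set.indicator_of_mem hy, Complex.ofReal_one, one_mul,
        ← coordForm_extDerivForm (hsm j) (P.chart_mem j) hy]
      exact coordForm_contractTwice hf (P.isAdaptedChart j) hh _ hy
    · rw [Set.indicator_of_notMem hy, Set.indicator_of_notMem hy]
      rfl
  -- The weights sum to 1 on a neighbourhood of the fibre, not merely on it, so the forms `d(ρ_j η)`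
  -- sum to `dη = 0` along the fibre.
  have hsum : ∑ j, chartFibreIntegral (ξ j) (P.chart j) (fun _ => 1) s = 0 := by
    rw [sum_chartFibreIntegral_eq (ξ' := 0)
      (fun j => fibreContinuous_contractTwice_extDerivForm hf hh (hsm j)) P.isAdaptedChart
      P.hasCompactSupport_weight P.tsupport_subset (fun j z hz => ?_) P
      (fun z hz => mem_of_mem_nhds (hK z hz)) (fun z hz => ?_)]
    · refine Finset.sum_eq_zero fun i _ => ?_
      rw [chartFibreIntegral_eq_integral]
      simp [fibreDensity, coordForm_zero]
    · have h1 : extDerivForm (smulForm (P.weight j) η) z = 0 := by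
        rw [extDerivForm_congr (β := 0), extDerivForm_zero]
        · rfl
        · filter_upwards [notMem_tsupport_iff_eventuallyEq.1 hz] with x hx
          exact smulForm_eq_zero_of_eq_zero η hx
      simp only [contractTwice, h1]
      rfl
    · have h1 : ∑ j, extDerivForm (smulForm (P.weight j) η) z = 0 := by
        rw [← sum_formField_apply, ← extDerivForm_sum _ hsm, extDerivForm_congr (β := η), hη.2]
        · rfl
        · filter_upwards [hK z hz] with x hx
          rw [sum_formField_apply]
          simp only [smulForm]
          rw [← Finset.sum_smul, ← Complex.ofReal_sum, P.sum_weight x hx, Complex.ofReal_one,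
            one_smul]
      ext v
      have h2 := DFunLike.congr_fun h1 (Fin.cons (h z) (Fin.cons (Complex.I • h z) v))
      rw [ContinuousAlternatingMap.sum_apply] at h2 ⊢
      exact h2
  simp only [hξ, Finset.sum_sub_distrib, ← Finset.mul_sum] at hsum
  -- What remains of `hsum` is the Cauchy–Riemann equation.
  rw [differentiableAt_complex_iff_differentiableAt_real]
  refine ⟨DifferentiableAt.fun_sum fun j _ => hd j, ?_⟩
  rw [fderiv_fun_sum fun j _ => hd j, sum_apply, sum_apply,
    smul_eq_mul]
  exact (sub_eq_zero.1 hsum).symm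

end Holomorphy

/-! ### Calculus along piecewise continuously differentiable paths. -/

section Paths

open MeasureTheory Set

variable {D : Set ℂ} {a b : ℂ} {γ : ℝ → ℂ}

/-- Induction on a bound `N` for the number of breakpoints inside the interval: splitting at one of
them leaves fewer in each half. -/
lemma integrableOn_deriv_of_piecewise (P : Finset ℝ) (hP : ∀ a b : ℝ, Icc a b ⊆ Icc 0 1 →
    (∀ t ∈ P, t ∉ Ioo a b) → ContDiffOn ℝ 1 γ (Icc a b)) (N : ℕ) :
    ∀ a b : ℝ, a ≤ b → Icc a b ⊆ Icc 0 1 → (P.filter fun t => t ∈ Ioo a b).card ≤ N →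
      IntegrableOn (deriv γ) (Icc a b) := by
  classical
  induction N with
  | zero =>
    intro a b hab hsub hcard
    rcases hab.eq_or_lt with rfl | hab
    · simp
    rw [Nat.le_zero, Finset.card_eq_zero, Finset.filter_eq_empty_iff] at hcard
    have hc := hP a b hsub hcard
    -- At the endpoints the two-sided `deriv` need not agree with the one-sided derivative; two
    -- points are negligible.
    rw [integrableOn_Icc_iff_integrableOn_Ioo]
    refine (((hc.continuousOn_derivWithin (uniqueDiffOn_Icc hab) le_rfl).integrableOn_Icc).mono_set
      Ioo_subset_Icc_self).congr_fun (fun t ht => ?_) measurableSet_Ioo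
    exact derivWithin_of_mem_nhds (Icc_mem_nhds ht.1 ht.2)
  | succ N ih =>
    intro a b hab hsub hcard
    rcases (P.filter fun t => t ∈ Ioo a b).eq_empty_or_nonempty with h | ⟨c, hc⟩
    · exact ih a b hab hsub (by rw [h]; simp)
    have hcP := (Finset.mem_filter.1 hc).1
    have hcI := (Finset.mem_filter.1 hc).2
    rw [← Icc_union_Icc_eq_Icc hcI.1.le hcI.2.le]
    have hlt : ∀ a' b', Ioo a' b' ⊆ Ioo a b → c ∉ Ioo a' b' →
        (P.filter fun t => t ∈ Ioo a' b').card ≤ N := by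
      intro a' b' h1 h2
      refine Nat.lt_succ_iff.1 (lt_of_lt_of_le (Finset.card_lt_card ?_) hcard)
      refine (Finset.ssubset_iff_of_subset fun t ht => ?_).2 ⟨c, hc, fun h => ?_⟩
      · rw [Finset.mem_filter] at ht ⊢
        exact ⟨ht.1, h1 ht.2⟩
      · exact h2 (Finset.mem_filter.1 h).2
    refine (ih a c hcI.1.le ?_ ?_).union (ih c b hcI.2.le ?_ ?_)
    · exact (Icc_subset_Icc_right hcI.2.le).trans hsub
    · exact hlt _ _ (Ioo_subset_Ioo_right hcI.2.le) fun h => lt_irrefl _ h.2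
    · exact (Icc_subset_Icc_left hcI.1.le).trans hsub
    · exact hlt _ _ (Ioo_subset_Ioo_left hcI.1.le) fun h => lt_irrefl _ h.1

lemma IsPiecewiseC1Path.integrableOn_deriv (hγ : IsPiecewiseC1Path D a b γ) :
    IntegrableOn (deriv γ) (Icc 0 1) := by
  obtain ⟨P, hP⟩ := hγ.piecewise
  exact integrableOn_deriv_of_piecewise P hP _ 0 1 zero_le_one subset_rfl le_rfl

lemma IsPiecewiseC1Path.exists_hasDerivAt (hγ : IsPiecewiseC1Path D a b γ) :
    ∃ S : Set ℝ, S.Countable ∧ ∀ t ∈ Ioo 0 1 \ S, HasDerivAt γ (deriv γ t) t := by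
  obtain ⟨P, hP⟩ := hγ.piecewise
  refine ⟨P, P.countable_toSet, fun t ht => ?_⟩
  have hnhds : Ioo (0 : ℝ) 1 \ P ∈ nhds t :=
    (isOpen_Ioo.sdiff P.finite_toSet.isClosed).mem_nhds ht
  obtain ⟨l, u, ⟨hl, hu⟩, hlu⟩ := mem_nhds_iff_exists_Ioo_subset.1 hnhds
  have hsub : Icc ((l + t) / 2) ((t + u) / 2) ⊆ Ioo l u := fun x hx =>
    ⟨by linarith [hx.1], by linarith [hx.2]⟩
  have hc := hP ((l + t) / 2) ((t + u) / 2)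
    (fun x hx => Ioo_subset_Icc_self (hlu (hsub hx)).1)
    (fun x hx hx' => (hlu (hsub (Ioo_subset_Icc_self hx'))).2 hx)
  exact ((hc.contDiffAt (Icc_mem_nhds (by linarith) (by linarith))).differentiableAt
    (by simp)).hasDerivAt

/-- The fundamental theorem of calculus along piecewise continuously differentiable paths. -/
lemma IsPiecewiseC1Path.integral_deriv_mul (hγ : IsPiecewiseC1Path D a b γ) {F Φ : ℂ → ℂ}
    (hF : ∀ s ∈ D, HasDerivAt F (Φ s) s)
    (hint : IntegrableOn (fun t => deriv γ t * Φ (γ t)) (Icc 0 1)) :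
    ∫ t in Icc 0 1, deriv γ t * Φ (γ t) = F b - F a := by
  obtain ⟨S, hS, hd⟩ := hγ.exists_hasDerivAt
  rw [integral_Icc_eq_integral_Ioc, ← intervalIntegral.integral_of_le zero_le_one,
    MeasureTheory.integral_eq_of_hasDerivAt_off_countable_of_le (F ∘ γ)
      (fun t => deriv γ t * Φ (γ t)) zero_le_one hS
      (fun t ht => (hF _ (hγ.mem t ht)).continuousAt.comp_continuousWithinAt
        (hγ.continuousOn t ht))
      (fun t ht => (hF _ (hγ.mem t (Ioo_subset_Icc_self ht.1))).scomp t (hd t ht))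
      ((intervalIntegrable_iff_integrableOn_Icc_of_le zero_le_one).2 hint),
    Function.comp_apply, Function.comp_apply, hγ.source, hγ.target]

end Paths

/-! ### Integrals over preimages of paths. -/

section PathPreimages

open MeasureTheory Set

variable {n : ℕ} {Z : Type*} [TopologicalSpace Z] [ChartedSpace (Fin (n + 1) → ℂ) Z]
  [IsManifold 𝓘(ℂ, Fin (n + 1) → ℂ) ω Z] {f : Z → ℂ}
  (hf : MDifferentiable 𝓘(ℂ, Fin (n + 1) → ℂ) 𝓘(ℂ, ℂ) f)
  {η : FormField (n + 1) Z (2 * n + 1)} {θ : FormField (n + 1) Z (2 * n)}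
  (hθ : IsGelfandLeray f η θ)

include hf hθ

/-- The integral over the preimage of a path, as an iterated integral. -/
lemma IsPiecewiseC1Path.chartPreimageIntegral_eq {D : Set ℂ} {a b : ℂ} {γ : ℝ → ℂ}
    (hγ : IsPiecewiseC1Path D a b γ) {φ : OpenPartialHomeomorph Z (Fin (n + 1) → ℂ)}
    (hφ : IsAdaptedChart f φ) {ρ : Z → ℝ} (hρ : Continuous ρ) (hc : HasCompactSupport ρ)
    (hs : tsupport ρ ⊆ φ.source) :
    IntegrableOn (fun t => deriv γ t * chartFibreIntegral θ φ ρ (γ t)) (Icc 0 1) ∧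
      chartPreimageIntegral η φ ρ γ =
        ∫ t in Icc 0 1, deriv γ t * chartFibreIntegral θ φ ρ (γ t) := by
  have hρ0 : ∀ z, z ∉ tsupport ρ → ρ z = 0 ∨ θ z = 0 := fun z hz =>
    Or.inl (image_eq_zero_of_notMem_tsupport hz)
  have hgc := continuous_fibreDensity (fibreContinuous_of_mem_smoothForms hθ.1) hφ hρ hc hs hρ0
  have hgs := hasCompactSupport_fibreDensity (φ := φ) (ξ := θ) hc hs hρ0
  obtain ⟨B, hB, hle⟩ := exists_integrable_bound_comp_cons hgc hgs
  -- For Fubini: the integrand is dominated by `‖γ' t‖ * B w`, a product of integrable functions of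
  -- separate variables.
  have hint : IntegrableOn (fun p : ℝ × (Fin n → ℂ) =>
      deriv γ p.1 * fibreDensity θ φ ρ (Fin.cons (γ p.1) p.2)) (Icc 0 1 ×ˢ univ)
      (volume.prod volume) := by
    have h1 : IntegrableOn (fun p : ℝ × (Fin n → ℂ) => ‖deriv γ p.1‖ * B p.2) (Icc 0 1 ×ˢ univ)
        (volume.prod volume) := by
      rw [IntegrableOn, ← Measure.prod_restrict, Measure.restrict_univ]
      exact hγ.integrableOn_deriv.norm.mul_prod hB
    refine Integrable.mono h1 (AEStronglyMeasurable.mul ?_ ?_) (Filter.Eventually.of_forall fun p => ?_)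
    · exact ((measurable_deriv γ).comp measurable_fst).aestronglyMeasurable
    · refine ContinuousOn.aestronglyMeasurable ?_ (measurableSet_Icc.prod MeasurableSet.univ)
      refine (hgc.comp continuous_cons).comp_continuousOn
        ((hγ.continuousOn.comp continuousOn_fst fun p hp => hp.1).prodMk continuousOn_snd)
    · rw [norm_mul, norm_mul, norm_norm]
      exact mul_le_mul_of_nonneg_left ((hle _ _).trans (le_abs_self _)) (norm_nonneg _)
  have hmul : ∀ t, ∫ w : Fin n → ℂ, deriv γ t * fibreDensity θ φ ρ (Fin.cons (γ t) w) =
      deriv γ t * chartFibreIntegral θ φ ρ (γ t) := fun t => by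
    rw [integral_const_mul, chartFibreIntegral_eq_integral]
  constructor
  · have h1 := hint
    rw [IntegrableOn, ← Measure.prod_restrict, Measure.restrict_univ] at h1
    simpa only [IntegrableOn, hmul] using h1.integral_prod_left
  · have h1 := setIntegral_prod _ hint
    simp only [Measure.restrict_univ, hmul] at h1
    rw [← h1, chartPreimageIntegral, Measure.volume_eq_prod]
    congr 1
    funext p
    rw [← hθ.extendedForm_cons hf hφ]
    by_cases hp : (Fin.cons (γ p.1) p.2 : Fin (n + 1) → ℂ) ∈ φ.target
    · rw [if_pos hp, extendedForm, indicator_of_mem hp]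
      rfl
    · rw [if_neg hp, extendedForm, indicator_of_notMem hp]
      rfl

variable [T2Space Z] (hfs : ∀ z, Function.Surjective (differentialAt (m := n + 1) f z))
  {U : Set ℂ} (hU : IsOpen U) (hfU : ∀ z, f z ∈ U) (hp : IsProperMap (codRestrict f U hfU))

include hfs hU hp

omit hθ in
lemma exists_adaptedPartition_preimage {K : Set ℂ} (hK : IsCompact K) (hKU : K ⊆ U) :
    ∃ P : AdaptedPartition (n := n) f (f ⁻¹' K),
      ∀ j, ContMDiff 𝓘(ℝ, Fin (n + 1) → ℂ) 𝓘(ℝ, ℝ) ∞ (P.weight j) := by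
  have := sigmaCompactSpace_of_isProperMap_codRestrict hU hfU hp
  exact exists_adaptedPartition_contMDiff hf hfs
    (isCompact_preimage_of_isProperMap_codRestrict hfU hp hK hKU)

/-- The partition chosen over the whole path also serves each single fibre above it. By
independence, the chart contributions at time `t` add up to the fibre integral over `γ t`, and the
fundamental theorem of calculus concludes. -/
lemma IsPiecewiseC1Path.preimageIntegral_eq {a b : ℂ} {γ : ℝ → ℂ}
    (hγ : IsPiecewiseC1Path U a b γ) {F : ℂ → ℂ}
    (hF : ∀ s ∈ U, HasDerivAt F (fibreIntegral f θ s) s) :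
    preimageIntegral f η γ = F b - F a := by
  have hsub : γ '' Icc 0 1 ⊆ U := by
    rintro _ ⟨t, ht, rfl⟩
    exact hγ.mem t ht
  have hP : Nonempty (AdaptedPartition (n := n) f (f ⁻¹' (γ '' Icc 0 1))) :=
    ⟨(exists_adaptedPartition_preimage hf hfs hU hfU hp (isCompact_Icc.image_of_continuousOn
      hγ.continuousOn) hsub).choose⟩
  rw [preimageIntegral, dif_pos hP]
  set P := hP.some
  have h1 := fun j => hγ.chartPreimageIntegral_eq hf hθ (P.isAdaptedChart j)
    (P.continuous_weight j) (P.hasCompactSupport_weight j) (P.tsupport_subset j)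
  have h2 : ∀ t ∈ Icc (0 : ℝ) 1, ∑ j, deriv γ t * chartFibreIntegral θ (P.chart j) (P.weight j)
      (γ t) = deriv γ t * fibreIntegral f θ (γ t) := by
    intro t ht
    rw [← Finset.mul_sum, P.sum_chartFibreIntegral_eq_fibreIntegral
      (fibreContinuous_of_mem_smoothForms hθ.1)]
    · exact fun z hz => ⟨t, ht, hz.symm⟩
    · exact ⟨(exists_adaptedPartition_preimage hf hfs hU hfU hp isCompact_singleton
        (singleton_subset_iff.2 (hγ.mem t ht))).choose⟩
  rw [Finset.sum_congr rfl fun j _ => (h1 j).2, ← integral_finsetSum _ fun j _ => (h1 j).1,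
    setIntegral_congr_fun measurableSet_Icc h2]
  refine hγ.integral_deriv_mul hF ?_
  exact IntegrableOn.congr_fun (integrable_finsetSum _ fun j _ => (h1 j).1) h2 measurableSet_Icc

/-- The fibre integrals of a Gelfand–Leray form of a closed form are holomorphic. -/
lemma differentiableAt_fibreIntegral (hη : η ∈ closedForms (n + 1) Z (2 * n + 1)) {s : ℂ}
    (hs : s ∈ U) : DifferentiableAt ℂ (fibreIntegral f θ) s := by
  obtain ⟨ε, hε, hεU⟩ := Metric.nhds_basis_closedBall.mem_iff.1 (hU.mem_nhds hs)
  -- `fibreIntegral` picks an unrelated partition for each fibre; one smooth partition over a closed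
  -- disc about `s` computes all nearby values at once.
  obtain ⟨P, hP⟩ := exists_adaptedPartition_preimage hf hfs hU hfU hp (isCompact_closedBall s ε) hεU
  refine (differentiableAt_sum_chartFibreIntegral hf hfs hη hθ P hP fun z hz =>
    hf.continuous.continuousAt.preimage_mem_nhds
      (hz ▸ Metric.closedBall_mem_nhds _ hε)).congr_of_eventuallyEq ?_
  filter_upwards [Metric.closedBall_mem_nhds s hε] with s' hs'
  refine (P.sum_chartFibreIntegral_eq_fibreIntegral (fibreContinuous_of_mem_smoothForms hθ.1)
    (preimage_mono (singleton_subset_iff.2 hs')) ?_).symm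
  exact ⟨(exists_adaptedPartition_preimage hf hfs hU hfU hp isCompact_singleton
    (singleton_subset_iff.2 (hεU hs'))).choose⟩

end PathPreimages

/-! ### The main theorem. -/

theorem proposition4 (n : ℕ)
    {X : Type*} [TopologicalSpace X] [T2Space X]
    [ChartedSpace (Fin (2 * n + 1) → ℂ) X]
    [IsManifold 𝓘(ℂ, Fin (2 * n + 1) → ℂ) ω X]
    {Z : Type*} [TopologicalSpace Z] [T2Space Z]
    [ChartedSpace (Fin (n + 1) → ℂ) Z]
    [IsManifold 𝓘(ℂ, Fin (n + 1) → ℂ) ω Z]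
    (r : ℝ) (f : Z → ℂ)
    (hf : MDifferentiable 𝓘(ℂ, Fin (n + 1) → ℂ) 𝓘(ℂ, ℂ) f)
    (hfD : ∀ z, f z ∈ Metric.ball (0 : ℂ) r)
    (hf_proper : IsProperMap (Set.codRestrict f (Metric.ball (0 : ℂ) r) hfD))
    (hf_subm : ∀ z, Function.Surjective (differentialAt (m := n + 1) f z))
    (g : Z → X)
    (hg : MDifferentiable 𝓘(ℂ, Fin (n + 1) → ℂ) 𝓘(ℂ, Fin (2 * n + 1) → ℂ) g)
    (c : DeRham (2 * n + 1) X (2 * n + 1))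
    (hc : c ∈ hodgeFiltration (2 * n + 1) X (n + 1) (2 * n + 1))
    (α : closedForms (2 * n + 1) X (2 * n + 1))
    (hα : (α : FormField (2 * n + 1) X (2 * n + 1)) ∈
      hodgeForms (2 * n + 1) X (n + 1) (2 * n + 1))
    (hαc : Submodule.Quotient.mk α = c)
    (s₀ : ℂ) :
    (∃ θ, IsGelfandLeray f (pullbackForm g (α : FormField (2 * n + 1) X (2 * n + 1))) θ) ∧
    ∀ θ, IsGelfandLeray f (pullbackForm g (α : FormField (2 * n + 1) X (2 * n + 1))) θ →
      ∀ γ : ℂ → ℝ → ℂ,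
        (∀ s ∈ Metric.ball (0 : ℂ) r,
          IsPiecewiseC1Path (Metric.ball (0 : ℂ) r) s₀ s (γ s)) →
        ∀ s ∈ Metric.ball (0 : ℂ) r,
          HasDerivAt
            (fun s' => preimageIntegral f
              (pullbackForm g (α : FormField (2 * n + 1) X (2 * n + 1))) (γ s'))
            (fibreIntegral f θ s) s := by

  have hη := pullbackForm_mem_closedForms hg α.2
  refine ⟨?_, fun θ hθ γ hγ s hs => ?_⟩
  · have := sigmaCompactSpace_of_isProperMap_codRestrict Metric.isOpen_ball hfD hf_proper
    exact exists_isGelfandLeray hf hf_subm (mem_closedForms_iff.1 hη).1 fun z =>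
      compContinuousLinearMap_mem_hodgeAlternating (hα (g z)) _
  · have hd : DifferentiableOn ℂ (fibreIntegral f θ) (Metric.ball 0 r) := fun s hs =>
      (differentiableAt_fibreIntegral hf hθ hf_subm Metric.isOpen_ball hfD hf_proper hη
        hs).differentiableWithinAt
    -- A holomorphic function on a disc has a primitive `F`. On the disc, the integral over the
    -- preimage of any admissible path to `s'` is `F s' - F s₀`, which gives both path independence
    -- and the derivative.
    obtain ⟨F, hF⟩ := hd.isExactOn_ball
    refine ((hF s hs).sub_const (F s₀)).congr_of_eventuallyEq ?_
    filter_upwards [Metric.isOpen_ball.mem_nhds hs] with s' hs'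
    exact (hγ s' hs').preimageIntegral_eq hf hθ hf_subm Metric.isOpen_ball hfD hf_proper hF
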